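/- Let $X$ be a real Banach space with a Schauder basis $(e_i)_{i\ge 1}$; let $\mathbb N=\{1,2,3,\dots\}$. For finite $F,G\subset\mathbb N$ write $F<G$ if every element of $F$ is smaller than every element of $G$, and $F\ge n$ if every element of $F$ is at least $n$. For families $\mathcal F,\mathcal G$ of finite subsets of $\mathbb N$, let $\mathcal F[\mathcal G]$ be the family of all unions $G_1\cup\dots\cup G_k$ of nonempty sets $G_1<\dots<G_k$ in $\mathcal G$ with $\{\min G_1,\dots,\min G_k\}\in\mathcal F$ (where $k=0$ is allowed if $\emptyset\in\mathcal F$), and let $[\mathcal F]^1=\mathcal F$, $[\mathcal F]^{n+1}=\mathcal F\bigl[[\mathcal F]^n\bigr]$. The Schreier classes $(\mathcal S_\alpha)_{\alpha<\omega_1}$ are $\mathcal S_0=\{\emptyset\}\cup\{\{n\}:n\in\mathbb N\}$, $\mathcal S_{\alpha+1}=\mathcal S_1[\mathcal S_\alpha]$ with $\mathcal S_1=\{\emptyset\}\cup\{F:|F|\le\min F\}$, and, for limit $\alpha$, $\mathcal S_\alpha=\{F:\ F\in\mathcal S_{\alpha_n}\text{ and }F\ge n\text{ for some }n\in\mathbb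 N\}$, where for each countable limit ordinal $\alpha$ an increasing sequence of ordinals $\alpha_n<\alpha$ with supremum $\alpha$ has been fixed (the choice is arbitrary). A block basis $(x_i)$ of $(e_i)$, written $(x_i)\prec(e_i)$, is a sequence of nonzero finite linear combinations of the $e_j$ with supports $\operatorname{supp}x_1<\operatorname{supp}x_2<\cdots$. For $(x_i)\prec(e_i)$ and an equivalent norm $|\cdot|$ on $X$, let $\delta_{\mathcal F}((x_i),|\cdot|)$ be the supremum of all $\delta\ge0$ such that $$\Bigl|\sum_{i=1}^k y_i\Bigr|\ \ge\ \delta\sum_{i=1}^k|y_i|$$ whenever $y_1,\dots,y_k$ are nonzero finite linear combinations of $(x_i)$ whose supports with respect to $(x_i)$ satisfy $\operatorname{supp}y_1<\dots<\operatorname{supp}y_k$ and $\{\min\operatorname{supp}y_1,\dots,\min\operatorname{supp}y_k\}\in\mathcal F$. Put $$\ddot\delta_{\mathcal F}(X)=\sup_{|\cdot|}\ \sup_{(x_i)\prec(e_i)}\delta_{\mathcal F}((x_i),|\cdot|),$$ the first supremum being over all norms $|\cdot|$ on $X$ equivalent to the given one, and $\ddot\delta_\alpha(X)=\ddot\delta_{\mathcal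 S_\alpha}(X)$. Then for every ordinal $\alpha<\omega_1$ and every $n\in\mathbb N$: (a) $\ddot\delta_{[\mathcal S_\alpha]^n}(X)=\bigl(\ddot\delta_\alpha(X)\bigr)^n$; (b) $\ddot\delta_{[\mathcal S_\alpha]^n}(X)=\ddot\delta_{\alpha\cdot n}(X)$; (c) $\ddot\delta_{\alpha\cdot n}(X)=\bigl(\ddot\delta_\alpha(X)\bigr)^n$. -/

import Mathlib

open scoped Ordinal NNReal ENNReal

/-!
Conventions. The index set `{1, 2, 3, …}` of bases and of the families of finite sets is
represented by Lean's `ℕ = {0, 1, 2, …}`: the Lean index `i` stands for the positive integer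
`i + 1`.  So "`|F| ≤ min F`" reads `∀ i ∈ F, F.card ≤ i + 1`, and "`F ≥ n + 1`" reads
`∀ i ∈ F, n ≤ i`.
-/

namespace AsymptoticL1

/-! ### Families of finite sets -/

/-- `F < G`: every element of `F` is smaller than every element of `G`. -/
def Precedes (F G : Finset ℕ) : Prop := ∀ i ∈ F, ∀ j ∈ G, i < j

/-- `min E`, for a nonempty finite set `E` (the only case in which it is used). -/
noncomputable def minElt (E : Finset ℕ) : ℕ := sInf (E : Set ℕ)

/-- Nonempty finite sets `E₁ < ⋯ < E_k` form an `F`-admissible sequence if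
`{min E₁, …, min E_k} ∈ F`. -/
def IsAdmissible (F : Set (Finset ℕ)) {k : ℕ} (E : Fin k → Finset ℕ) : Prop :=
  (∀ i, (E i).Nonempty) ∧ (∀ i j, i < j → Precedes (E i) (E j)) ∧
    Finset.univ.image (fun i => minElt (E i)) ∈ F

/-- `F[G]`: all unions `G₁ ∪ ⋯ ∪ G_k` with `G₁ < ⋯ < G_k`, `Gᵢ ∈ G` and
`{min G₁, …, min G_k} ∈ F`. -/
def comp (F G : Set (Finset ℕ)) : Set (Finset ℕ) :=
  {A | ∃ (k : ℕ) (E : Fin k → Finset ℕ),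
    IsAdmissible F E ∧ (∀ i, E i ∈ G) ∧ A = Finset.univ.biUnion E}

/-- `S₀`: the empty set and all singletons. -/
def schreierZero : Set (Finset ℕ) := {A | A = ∅ ∨ ∃ n, A = {n}}

/-- `S₁`: the sets `F` with `|F| ≤ min F`, and the empty set. -/
def schreierOne : Set (Finset ℕ) := {A | ∀ i ∈ A, A.card ≤ i + 1}

/-- The powers `[F]¹ = F`, `[F]ⁿ⁺¹ = F[[F]ⁿ]`, with the convention `[F]⁰ = S₀`. -/
def famPow (F : Set (Finset ℕ)) : ℕ → Set (Finset ℕ)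
  | 0 => schreierZero
  | 1 => F
  | n + 2 => comp F (famPow F (n + 1))

/-- A choice, for every countable limit ordinal `α`, of a sequence `αₙ ↑ α`:
ordinals `αₙ < α`, increasing in `n`, with supremum `α`. -/
def IsLadderSystem (c : Ordinal.{0} → ℕ → Ordinal.{0}) : Prop :=
  ∀ α < ω₁, Order.IsSuccLimit α →
    Monotone (c α) ∧ (∀ n, c α n < α) ∧ ∀ β < α, ∃ n, β < c α n

/-- The Schreier classes built on the choice `c` of approximating sequences:
`S₀` as above, `S_{α+1} = S₁[S_α]` and, for limit `α`,
`S_α = {F : for some n ≥ 1, F ∈ S_{αₙ} and F ≥ n}`. -/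
noncomputable def schreier (c : Ordinal.{0} → ℕ → Ordinal.{0}) (α : Ordinal.{0}) :
    Set (Finset ℕ) :=
  Ordinal.limitRecOn (motive := fun _ => Set (Finset ℕ)) α schreierZero
    (fun _ S => comp schreierOne S)
    (fun β _ S => {A | ∃ (n : ℕ) (h : c β n < β), A ∈ S (c β n) h ∧ ∀ i ∈ A, n ≤ i})

/-! ### Block bases, equivalent norms and the asymptotic constants -/

section

variable {X : Type*} [NormedAddCommGroup X] [NormedSpace ℝ X]

/-- `(xᵢ) ≺ (eᵢ)`: the `xᵢ` are nonzero finite linear combinations of the `eⱼ` with successive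
supports. -/
def IsBlockBasis (x e : ℕ → X) : Prop :=
  ∃ a : ℕ → (ℕ →₀ ℝ), (∀ i, a i ≠ 0) ∧
    (∀ i, Precedes (a i).support (a (i + 1)).support) ∧
    ∀ i, x i = Finsupp.linearCombination ℝ e (a i)

/-- `p` is a norm on `X` equivalent to the given one. -/
def IsEquivNorm (p : Seminorm ℝ X) : Prop :=
  ∃ c C : ℝ, 0 < c ∧ 0 < C ∧ ∀ x, c * ‖x‖ ≤ p x ∧ p x ≤ C * ‖x‖

/-- `δ` is a lower `ℓ₁` constant of `(xᵢ)` in the norm `p` on `F`-admissible blocks: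
`p (y₁ + ⋯ + y_k) ≥ δ (p y₁ + ⋯ + p y_k)` for all nonzero `y₁ < ⋯ < y_k` in the span of `(xᵢ)` with
`F`-admissible supports with respect to `(xᵢ)`. The vectors are given by their coefficients. -/
def HasLowerConstant (F : Set (Finset ℕ)) (x : ℕ → X) (p : Seminorm ℝ X) (δ : ℝ≥0) : Prop :=
  ∀ (k : ℕ) (a : Fin k → (ℕ →₀ ℝ)), IsAdmissible F (fun i => (a i).support) →
    (δ : ℝ) * ∑ i, p (Finsupp.linearCombination ℝ x (a i)) ≤
      p (∑ i, Finsupp.linearCombination ℝ x (a i))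

/-- `δ_F((xᵢ), p)`, the supremum of all `δ ≥ 0` as above. -/
noncomputable def delta (F : Set (Finset ℕ)) (x : ℕ → X) (p : Seminorm ℝ X) : ℝ≥0∞ :=
  ⨆ (δ : ℝ≥0) (_ : HasLowerConstant F x p δ), (δ : ℝ≥0∞)

/-- `δ̇_F((eᵢ), p)`, the supremum of `δ_F((xᵢ), p)` over all block bases `(xᵢ)` of `(eᵢ)`. -/
noncomputable def dotDelta (F : Set (Finset ℕ)) (e : ℕ → X) (p : Seminorm ℝ X) : ℝ≥0∞ :=
  ⨆ (x : ℕ → X) (_ : IsBlockBasis x e), delta F x p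

/-- `δ̈_F(X) = δ̈_F(eᵢ)`, the supremum of `δ̇_F((eᵢ), p)` over all equivalent norms `p` on `X`. -/
noncomputable def ddotDelta (F : Set (Finset ℕ)) (e : ℕ → X) : ℝ≥0∞ :=
  ⨆ (p : Seminorm ℝ X) (_ : IsEquivNorm p), dotDelta F e p

end

end AsymptoticL1

namespace AsymptoticL1

/-! Write `F` for `S_α`, which is hereditary and spreading (`IsRegular`).

For (b), `[F]^n` and `S_{α·n}` need not coincide, but each embeds into the other along a subsequence
of the indices. This follows by induction from mutual embeddings of `S_{γ+β}` and `S_β[S_γ]`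
(`embeds_schreier_add`, `embeds_comp_schreier`). Since a subsequence of a block basis is a block
basis, an embedding compares the constants (`ddotDelta_le_of_embeds`).

For (a), iterating a lower estimate `δ` on `F` gives `δ ^ n` on `[F]^n`, which is one inequality.
Conversely, let a norm `p` have constant `δ` on `[F]^n` along some block basis, and let `t ^ n < δ`.
Iteration gives `δ ^ l` on `[F]^N` with `N = n * l`. Let `‖y‖_j` be the supremum, over `A ∈ [F]^j`,
of the sum of the sizes of the pieces into which `A` cuts `y`, and put `P = ∑_{j<N} t^j ‖·‖_j`. For
`F`-admissible blocks with sum `Y`, the sum of their `‖·‖_j` is at most `‖Y‖_{j+1}`, so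
multiplication by `t` shifts the series by one place. The new last term satisfies `t^N ‖Y‖_N ≤ t^N
C² δ^{-l} p Y ≤ ‖Y‖_0` for large `l`, where `C` bounds interval projections. Hence `P` has constant
`t` on `F` (`exists_renorming`), and `P` extends to an equivalent norm on `X`
(`exists_equivNorm_extending`). -/

/-- A family of finite sets is regular if it is hereditary and spreading: it contains every `B`
which has an order embedding `f` with `f b ≤ b` into one of its members. -/
def IsRegular (F : Set (Finset ℕ)) : Prop :=
  ∀ A ∈ F, ∀ (B : Finset ℕ) (f : ℕ → ℕ), StrictMonoOn f B → (∀ b ∈ B, f b ∈ A ∧ f b ≤ b) → B ∈ F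

/-! ### Compositions of regular families -/

theorem minElt_mem {E : Finset ℕ} (h : E.Nonempty) : minElt E ∈ E := by
  have := Nat.sInf_mem (s := (E : Set ℕ)) h
  exact this

theorem minElt_le {E : Finset ℕ} {i : ℕ} (h : i ∈ E) : minElt E ≤ i :=
  Nat.sInf_le (s := (E : Set ℕ)) h

theorem IsRegular.image_mem {F : Set (Finset ℕ)} (hF : IsRegular F) {A B : Finset ℕ} {s g : ℕ → ℕ}
    (hB : B ∈ F) (h : ∀ a ∈ A, g a ∈ B ∧ g a ≤ s a)
    (hs : ∀ a ∈ A, ∀ a' ∈ A, s a < s a' → g a < g a') : A.image s ∈ F := by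
  have hex : ∀ b ∈ A.image s, ∃ a ∈ A, s a = b := fun b hb => by simpa using hb
  choose! r hr hrs using hex
  refine hF B hB _ (g ∘ r) ?_ ?_
  · intro b hb b' hb' hlt
    have hb := Finset.mem_coe.1 hb
    have hb' := Finset.mem_coe.1 hb'
    exact hs _ (hr b hb) _ (hr b' hb') (by rwa [hrs b hb, hrs b' hb'])
  · intro b hb
    refine ⟨(h _ (hr b hb)).1, ?_⟩
    have := (h _ (hr b hb)).2
    rwa [hrs b hb] at this

theorem IsRegular.subset_mem {F : Set (Finset ℕ)} (hF : IsRegular F) {A B : Finset ℕ}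
    (hA : A ∈ F) (h : B ⊆ A) : B ∈ F :=
  hF A hA B id (fun _ _ _ _ h => h) (fun _ hb => ⟨h hb, le_rfl⟩)

/-- Label each point by the minimum of its block. Blocks become fibres of a monotone idempotent map,
which is easier to compose and transport than an indexed sequence of sets. -/
theorem exists_label_of_mem_comp {F G : Set (Finset ℕ)} {A : Finset ℕ} (hA : A ∈ comp F G) :
    ∃ h : ℕ → ℕ, (∀ a ∈ A, h a ∈ A ∧ h a ≤ a ∧ h (h a) = h a) ∧ MonotoneOn h A ∧
      A.image h ∈ F ∧ ∀ m ∈ A.image h, A.filter (fun a => h a = m) ∈ G := by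
  obtain ⟨k, E, ⟨hne, hprec, hmem⟩, hG, rfl⟩ := hA
  have huniq : ∀ i j a, a ∈ E i → a ∈ E j → i = j := by
    intro i j a hi hj
    rcases lt_trichotomy i j with h | h | h
    · exact absurd (hprec i j h a hi a hj) (lt_irrefl _)
    · exact h
    · exact absurd (hprec j i h a hj a hi) (lt_irrefl _)
  have hex : ∀ a ∈ Finset.univ.biUnion E, ∃ m, ∃ i, a ∈ E i ∧ m = minElt (E i) := by
    intro a ha
    obtain ⟨i, -, hi⟩ := Finset.mem_biUnion.1 ha
    exact ⟨_, i, hi, rfl⟩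
  choose! h hh using hex
  have hE : ∀ i, ∀ a ∈ E i, h a = minElt (E i) := by
    intro i a ha
    obtain ⟨j, hj, e⟩ := hh a (Finset.mem_biUnion.2 ⟨i, Finset.mem_univ _, ha⟩)
    rw [e, huniq i j a ha hj]
  have himg : (Finset.univ.biUnion E).image h = Finset.univ.image (fun i => minElt (E i)) := by
    ext m
    simp only [Finset.mem_image, Finset.mem_biUnion, Finset.mem_univ, true_and]
    constructor
    · rintro ⟨a, ⟨i, hi⟩, rfl⟩
      exact ⟨i, (hE i a hi).symm⟩
    · rintro ⟨i, rfl⟩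
      exact ⟨_, ⟨i, minElt_mem (hne i)⟩, hE i _ (minElt_mem (hne i))⟩
  refine ⟨h, ?_, ?_, himg ▸ hmem, ?_⟩
  · intro a ha
    obtain ⟨i, -, hi⟩ := Finset.mem_biUnion.1 ha
    rw [hE i a hi]
    exact ⟨Finset.mem_biUnion.2 ⟨i, Finset.mem_univ _, minElt_mem (hne i)⟩, minElt_le hi,
      hE i _ (minElt_mem (hne i))⟩
  · intro a ha b hb hab
    obtain ⟨i, -, hi⟩ := Finset.mem_biUnion.1 (Finset.mem_coe.1 ha)
    obtain ⟨j, -, hj⟩ := Finset.mem_biUnion.1 (Finset.mem_coe.1 hb)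
    rw [hE i a hi, hE j b hj]
    rcases lt_trichotomy i j with h | h | h
    · exact (hprec i j h _ (minElt_mem (hne i)) _ (minElt_mem (hne j))).le
    · rw [h]
    · exact absurd (hprec j i h b hj a hi) (not_lt.2 hab)
  · intro m hm
    rw [himg] at hm
    obtain ⟨i, -, rfl⟩ := Finset.mem_image.1 hm
    convert hG i using 1
    ext a
    simp only [Finset.mem_filter, Finset.mem_biUnion, Finset.mem_univ, true_and]
    constructor
    · rintro ⟨⟨j, hj⟩, e⟩
      rw [hE j a hj] at e
      have h1 := minElt_mem (hne j)
      rw [e] at h1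
      rwa [huniq i j _ (minElt_mem (hne i)) h1]
    · exact fun ha => ⟨⟨i, ha⟩, hE i a ha⟩

/-- Fibres of a monotone map are successive. A label need not be the minimum of its fibre, or even
lie in `A`: it is at most that minimum, so the set of minima is a spread of a subset of `M`. -/
theorem IsRegular.mem_comp {F G : Set (Finset ℕ)} (hF : IsRegular F) {A M : Finset ℕ} {h : ℕ → ℕ}
    (hM : M ∈ F) (hmono : MonotoneOn h A) (hh : ∀ a ∈ A, h a ∈ M ∧ h a ≤ a)
    (hG : ∀ m ∈ M, A.filter (fun a => h a = m) ∈ G) : A ∈ comp F G := by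
  set o := (A.image h).orderEmbOfFin rfl with ho
  have hoA : ∀ i, ∃ a ∈ A, h a = o i := fun i =>
    Finset.mem_image.1 (Finset.orderEmbOfFin_mem _ rfl i)
  have hne : ∀ i, (A.filter (fun a => h a = o i)).Nonempty := fun i => by
    obtain ⟨a, ha, e⟩ := hoA i
    exact ⟨a, Finset.mem_filter.2 ⟨ha, e⟩⟩
  have hmin := fun i => Finset.mem_filter.1 (minElt_mem (hne i))
  refine ⟨_, fun i => A.filter (fun a => h a = o i), ⟨hne, ?_, ?_⟩, ?_, ?_⟩
  · intro i j hij a ha b hb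
    simp only [Finset.mem_filter] at ha hb
    by_contra hle
    have := hmono hb.1 ha.1 (not_lt.1 hle)
    rw [ha.2, hb.2] at this
    exact absurd (o.strictMono hij) (not_lt.2 this)
  · have hmem : ∀ b ∈ Finset.univ.image (fun i => minElt (A.filter (fun a => h a = o i))),
        ∃ i, minElt (A.filter (fun a => h a = o i)) = b := fun b hb => by simpa using hb
    refine hF M hM _ h ?_ ?_
    · intro b hb b' hb' hlt
      obtain ⟨i, rfl⟩ := hmem b hb
      obtain ⟨j, rfl⟩ := hmem b' hb'
      refine lt_of_le_of_ne (hmono (hmin i).1 (hmin j).1 hlt.le) fun e => ?_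
      rw [(hmin i).2, (hmin j).2] at e
      rw [e] at hlt
      exact lt_irrefl _ hlt
    · intro b hb
      obtain ⟨i, rfl⟩ := hmem b hb
      exact hh _ (hmin i).1
  · intro i
    obtain ⟨a, ha, e⟩ := hoA i
    exact hG _ (e ▸ (hh a ha).1)
  · ext a
    simp only [Finset.mem_filter, Finset.mem_biUnion, Finset.mem_univ, true_and]
    refine ⟨fun ha => ?_, fun ⟨i, hi⟩ => hi.1⟩
    have : h a ∈ Set.range o := by
      rw [ho, Finset.range_orderEmbOfFin]
      exact Finset.mem_coe.2 (Finset.mem_image_of_mem h ha)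
    obtain ⟨i, hi⟩ := this
    exact ⟨i, ha, hi.symm⟩

theorem isRegular_schreierZero : IsRegular schreierZero := by
  intro A hA B f hf hB
  rcases B.eq_empty_or_nonempty with rfl | ⟨b, hb⟩
  · exact Or.inl rfl
  · refine Or.inr ⟨b, Finset.eq_singleton_iff_unique_mem.2 ⟨hb, fun b' hb' => ?_⟩⟩
    apply hf.injOn hb' hb
    rcases hA with rfl | ⟨n, rfl⟩
    · simpa using (hB b hb).1
    · rw [Finset.mem_singleton.1 (hB b hb).1, Finset.mem_singleton.1 (hB b' hb').1]

theorem isRegular_schreierOne : IsRegular schreierOne := by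
  intro A hA B f hf hB b hb
  calc B.card ≤ A.card := Finset.card_le_card_of_injOn f (fun b hb => (hB b hb).1) hf.injOn
    _ ≤ f b + 1 := hA _ (hB b hb).1
    _ ≤ b + 1 := by have := (hB b hb).2; omega

theorem IsRegular.comp {F G : Set (Finset ℕ)} (hF : IsRegular F) (hG : IsRegular G) :
    IsRegular (comp F G) := by
  intro A hA B f hf hB
  obtain ⟨h, hh, hmono, hM, hfib⟩ := exists_label_of_mem_comp hA
  refine hF.mem_comp (h := h ∘ f) hM ?_ ?_ ?_
  · intro b hb b' hb' hbb'
    exact hmono (hB b hb).1 (hB b' hb').1 (hf.monotoneOn hb hb' hbb')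
  · intro b hb
    exact ⟨Finset.mem_image_of_mem _ (hB b hb).1, (hh _ (hB b hb).1).2.1.trans (hB b hb).2⟩
  · intro m hm
    refine hG _ (hfib m hm) _ f (hf.mono fun _ hb => (Finset.mem_filter.1 hb).1) ?_
    intro b hb
    obtain ⟨hb, e⟩ := Finset.mem_filter.1 hb
    exact ⟨Finset.mem_filter.2 ⟨(hB b hb).1, e⟩, (hB b hb).2⟩

theorem subset_comp {F G : Set (Finset ℕ)} (hF : IsRegular F) (hs : ∀ n, {n} ∈ F) :
    G ⊆ comp F G := by
  intro A hA
  refine hF.mem_comp (h := fun _ => minElt A) (hs (minElt A)) (fun _ _ _ _ _ => le_rfl)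
    (fun a ha => ⟨Finset.mem_singleton_self _, minElt_le ha⟩) ?_
  intro m hm
  rw [Finset.filter_true_of_mem fun a _ => (Finset.mem_singleton.1 hm).symm]
  exact hA

theorem comp_schreierZero {F : Set (Finset ℕ)} (hF : IsRegular F) : comp F schreierZero = F := by
  ext A
  constructor
  · intro hA
    obtain ⟨h, hh, hmono, hM, hfib⟩ := exists_label_of_mem_comp hA
    refine hF _ hM A h ?_ fun a ha => ⟨Finset.mem_image_of_mem _ ha, (hh a ha).2.1⟩
    intro a ha b hb hab
    refine lt_of_le_of_ne (hmono ha hb hab.le) fun e => hab.ne ?_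
    have ha' : a ∈ A.filter (fun x => h x = h b) := Finset.mem_filter.2 ⟨ha, e⟩
    have hb' : b ∈ A.filter (fun x => h x = h b) := Finset.mem_filter.2 ⟨hb, rfl⟩
    rcases hfib (h b) (Finset.mem_image_of_mem _ hb) with h0 | ⟨n, h0⟩
    · rw [h0] at ha'
      simp at ha'
    · rw [h0, Finset.mem_singleton] at ha' hb'
      rw [ha', hb']
  · intro hA
    refine hF.mem_comp (h := id) hA (fun _ _ _ _ h => h) (fun a ha => ⟨ha, le_rfl⟩) ?_
    intro m hm
    refine Or.inr ⟨m, ?_⟩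
    ext a
    simp only [id, Finset.mem_filter, Finset.mem_singleton]
    exact ⟨fun h => h.2, fun h => ⟨h ▸ hm, h⟩⟩

theorem schreierZero_comp {G : Set (Finset ℕ)} (hG : ∅ ∈ G) : comp schreierZero G = G := by
  refine Set.Subset.antisymm (fun A hA => ?_)
    (subset_comp isRegular_schreierZero fun n => Or.inr ⟨n, rfl⟩)
  obtain ⟨h, hh, hmono, hM, hfib⟩ := exists_label_of_mem_comp hA
  rcases hM with h0 | ⟨n, h0⟩
  · rw [Finset.image_eq_empty] at h0
    rwa [h0]
  · have h1 := hfib n (by rw [h0]; exact Finset.mem_singleton_self n)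
    rwa [Finset.filter_true_of_mem fun a ha => by
      have := Finset.mem_image_of_mem h ha
      rwa [h0, Finset.mem_singleton] at this] at h1

/-- From left to right, `h` labels the outer blocks and `g m` the inner blocks of the outer block
`m`, so `g (h a) a` labels the inner block of `a`. From right to left, the labels of the two levels
compose to `l ∘ h`. -/
theorem comp_assoc {F G H : Set (Finset ℕ)} (hF : IsRegular F) (hG : IsRegular G)
    (hH : IsRegular H) : comp F (comp G H) = comp (comp F G) H := by
  ext A
  constructor
  · intro hA
    obtain ⟨h, hh, hmono, hM, hfib⟩ := exists_label_of_mem_comp hA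
    have hex : ∀ m ∈ A.image h, ∃ g : ℕ → ℕ, _ := fun m hm =>
      exists_label_of_mem_comp (hfib m hm)
    choose! g hg hgmono hgM hgfib using hex
    have hmem : ∀ a ∈ A, a ∈ A.filter (fun x => h x = h a) := fun a ha =>
      Finset.mem_filter.2 ⟨ha, rfl⟩
    have him : ∀ a ∈ A, h a ∈ A.image h := fun a ha => Finset.mem_image_of_mem h ha
    have hr : ∀ a ∈ A, g (h a) a ∈ A ∧ h (g (h a) a) = h a ∧ g (h a) a ≤ a := fun a ha => by
      have h1 := hg (h a) (him a ha) a (hmem a ha)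
      have h2 := Finset.mem_filter.1 h1.1
      exact ⟨h2.1, h2.2, h1.2.1⟩
    refine (hF.comp hG).mem_comp (h := fun a => g (h a) a) (M := A.image fun a => g (h a) a)
      ?_ ?_ ?_ ?_
    · refine hF.mem_comp (h := h) hM ?_ ?_ ?_
      · refine hmono.mono fun x hx => ?_
        obtain ⟨a, ha, rfl⟩ := Finset.mem_image.1 (Finset.mem_coe.1 hx)
        exact (hr a ha).1
      · intro x hx
        obtain ⟨a, ha, rfl⟩ := Finset.mem_image.1 hx
        exact ⟨him _ (hr a ha).1, (hh _ (hr a ha).1).2.1⟩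
      · intro m hm
        refine hG.subset_mem (hgM m hm) fun x hx => ?_
        obtain ⟨hx, e⟩ := Finset.mem_filter.1 hx
        obtain ⟨a, ha, rfl⟩ := Finset.mem_image.1 hx
        rw [(hr a ha).2.1] at e
        subst e
        exact Finset.mem_image_of_mem _ (hmem a ha)
    · intro a ha b hb hab
      have ha := Finset.mem_coe.1 ha
      have hb := Finset.mem_coe.1 hb
      rcases (hmono ha hb hab).lt_or_eq with hlt | e
      · by_contra hc
        have := hmono (hr b hb).1 (hr a ha).1 (not_le.1 hc).le
        rw [(hr a ha).2.1, (hr b hb).2.1] at this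
        exact absurd hlt (not_lt.2 this)
      · show g (h a) a ≤ g (h b) b
        rw [e]
        exact hgmono (h b) (him b hb) (Finset.mem_coe.2 (e ▸ hmem a ha))
          (Finset.mem_coe.2 (hmem b hb)) hab
    · exact fun a ha => ⟨Finset.mem_image_of_mem _ ha, (hr a ha).2.2⟩
    · intro x hx
      obtain ⟨a, ha, rfl⟩ := Finset.mem_image.1 hx
      refine hH.subset_mem (hgfib (h a) (him a ha) (g (h a) a)
        (Finset.mem_image_of_mem _ (hmem a ha))) fun b hb => ?_
      obtain ⟨hb, e⟩ := Finset.mem_filter.1 hb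
      have e1 : h b = h a := by rw [← (hr b hb).2.1, e, (hr a ha).2.1]
      exact Finset.mem_filter.2 ⟨Finset.mem_filter.2 ⟨hb, e1⟩, by rw [← e, e1]⟩
  · intro hA
    obtain ⟨h, hh, hmono, hM, hfib⟩ := exists_label_of_mem_comp hA
    obtain ⟨l, hl, hlmono, hL, hlfib⟩ := exists_label_of_mem_comp hM
    have him : ∀ a ∈ A, h a ∈ A.image h := fun a ha => Finset.mem_image_of_mem h ha
    refine hF.mem_comp (h := l ∘ h) hL ?_ ?_ ?_
    · intro a ha b hb hab
      exact hlmono (Finset.mem_coe.2 (him a ha)) (Finset.mem_coe.2 (him b hb)) (hmono ha hb hab)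
    · intro a ha
      exact ⟨Finset.mem_image_of_mem _ (him a ha), (hl _ (him a ha)).2.1.trans (hh a ha).2.1⟩
    · intro m hm
      refine hG.mem_comp (h := h) (hlfib m hm) (hmono.mono fun x hx => ?_) ?_ ?_
      · exact (Finset.mem_filter.1 hx).1
      · intro a ha
        obtain ⟨ha, e⟩ := Finset.mem_filter.1 ha
        exact ⟨Finset.mem_filter.2 ⟨him a ha, e⟩, (hh a ha).2.1⟩
      · intro x hx
        exact hH.subset_mem (hfib x (Finset.mem_filter.1 hx).1)
          (Finset.filter_subset_filter _ (Finset.filter_subset _ _))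

/-! ### Embedding families along subsequences -/

/-- `F` embeds into `G` along a subsequence. -/
def Embeds (F G : Set (Finset ℕ)) : Prop :=
  ∃ φ : ℕ → ℕ, StrictMono φ ∧ ∀ A ∈ F, A.image φ ∈ G

theorem IsRegular.image_mem_of_le {G : Set (Finset ℕ)} (hG : IsRegular G) {A : Finset ℕ}
    {φ ψ : ℕ → ℕ} (hφ : StrictMono φ) (hψ : StrictMono ψ) (h : A.image φ ∈ G)
    (hle : ∀ a ∈ A, φ a ≤ ψ a) : A.image ψ ∈ G :=
  hG.image_mem (g := φ) h (fun a ha => ⟨Finset.mem_image_of_mem _ ha, hle a ha⟩)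
    fun _ _ _ _ hlt => hφ (hψ.lt_iff_lt.1 hlt)

theorem Embeds.of_subset {F G : Set (Finset ℕ)} (h : F ⊆ G) : Embeds F G :=
  ⟨id, strictMono_id, fun A hA => by simpa using h hA⟩

theorem Embeds.trans {F G H : Set (Finset ℕ)} : Embeds F G → Embeds G H → Embeds F H := by
  rintro ⟨φ, hφ, h1⟩ ⟨ψ, hψ, h2⟩
  exact ⟨ψ ∘ φ, hψ.comp hφ, fun A hA => by
    rw [← Finset.image_image]; exact h2 _ (h1 A hA)⟩

theorem Embeds.comp {F F' G G' : Set (Finset ℕ)} (hF' : IsRegular F') (hG' : IsRegular G') :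
    Embeds F F' → Embeds G G' → Embeds (comp F G) (comp F' G') := by
  rintro ⟨φ, hφ, h1⟩ ⟨ψ, hψ, h2⟩
  -- The sum dominates both embeddings, so spreading lets it replace `φ` on the labels and `ψ` on
  -- the fibres.
  have hχ : StrictMono (φ + ψ) := fun a b hab => add_lt_add (hφ hab) (hψ hab)
  refine ⟨φ + ψ, hχ, fun A hA => ?_⟩
  obtain ⟨h, hh, hmono, hM, hfib⟩ := exists_label_of_mem_comp hA
  have hinv := Function.leftInverse_invFun hχ.injective
  refine hF'.mem_comp (h := fun b => (φ + ψ) (h (Function.invFun (φ + ψ) b)))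
    (hF'.image_mem_of_le hφ hχ (h1 _ hM) fun a _ => Nat.le_add_right _ _) ?_ ?_ ?_
  · intro x hx y hy hxy
    obtain ⟨a, ha, rfl⟩ := Finset.mem_image.1 (Finset.mem_coe.1 hx)
    obtain ⟨b, hb, rfl⟩ := Finset.mem_image.1 (Finset.mem_coe.1 hy)
    simp only [hinv _]
    exact hχ.monotone (hmono ha hb (hχ.le_iff_le.1 hxy))
  · intro x hx
    obtain ⟨a, ha, rfl⟩ := Finset.mem_image.1 hx
    simp only [hinv _]
    exact ⟨Finset.mem_image_of_mem _ (Finset.mem_image_of_mem _ ha),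
      hχ.monotone (hh a ha).2.1⟩
  · intro x hx
    obtain ⟨m, hm, rfl⟩ := Finset.mem_image.1 hx
    have := hG'.image_mem_of_le hψ hχ (h2 _ (hfib m hm)) fun a _ => Nat.le_add_left _ _
    convert this using 1
    ext x
    simp only [Finset.mem_filter, Finset.mem_image]
    constructor
    · rintro ⟨⟨a, ha, rfl⟩, e⟩
      rw [hinv] at e
      exact ⟨a, ⟨ha, hχ.injective e⟩, rfl⟩
    · rintro ⟨a, ⟨ha, e⟩, rfl⟩
      exact ⟨⟨a, ha, rfl⟩, by rw [hinv, e]⟩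

/-- Countably many embeddings can be diagonalized. -/
theorem Embeds.diagonal {F G : Set (Finset ℕ)} {K : ℕ → Set (Finset ℕ)} (hG : IsRegular G)
    (hF : ∀ A ∈ F, ∃ n, A ∈ K n ∧ ∀ i ∈ A, n ≤ i) (h : ∀ n, Embeds (K n) G) : Embeds F G := by
  choose φ hφ hK using h
  -- At `i` this map dominates `φ n i` for all `n ≤ i`. That suffices, since a member of `F` taken
  -- from `K n` has no element below `n`.
  have hχ : StrictMono fun i => i + ∑ n ∈ Finset.range (i + 1), φ n i := by
    refine strictMono_nat_of_lt_succ fun i => ?_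
    refine add_lt_add_of_lt_of_le (Nat.lt_succ_self i) ?_
    calc ∑ n ∈ Finset.range (i + 1), φ n i ≤ ∑ n ∈ Finset.range (i + 1), φ n (i + 1) :=
          Finset.sum_le_sum fun n _ => (hφ n).monotone (Nat.le_succ i)
      _ ≤ _ := Finset.sum_le_sum_of_subset (Finset.range_subset_range.2 (Nat.le_succ _))
  refine ⟨_, hχ, fun A hA => ?_⟩
  obtain ⟨n, hn, hle⟩ := hF A hA
  refine hG.image_mem_of_le (hφ n) hχ (hK n A hn) fun a ha => ?_
  have h1 : n ∈ Finset.range (a + 1) := Finset.mem_range.2 (Nat.lt_succ_of_le (hle a ha))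
  exact (Finset.single_le_sum (f := fun n => φ n a) (fun _ _ => Nat.zero_le _) h1).trans
    (Nat.le_add_left _ _)

theorem IsRegular.embeds_of_ge {F G : Set (Finset ℕ)} (hF : IsRegular F) (n : ℕ)
    (h : ∀ A ∈ F, (∀ i ∈ A, n ≤ i) → A ∈ G) : Embeds F G := by
  refine ⟨(· + n), fun a b hab => Nat.add_lt_add_right hab n, fun A hA => h _ ?_ ?_⟩
  · exact hF.image_mem (g := id) hA (fun a ha => ⟨ha, Nat.le_add_right _ _⟩)
      fun _ _ _ _ hlt => Nat.lt_of_add_lt_add_right hlt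
  · intro i hi
    obtain ⟨a, -, rfl⟩ := Finset.mem_image.1 hi
    exact Nat.le_add_left _ _

/-! ### Powers of a family -/

theorem IsRegular.famPow {F : Set (Finset ℕ)} (hF : IsRegular F) : ∀ n, IsRegular (famPow F n)
  | 0 => isRegular_schreierZero
  | 1 => hF
  | n + 2 => hF.comp (hF.famPow (n + 1))

theorem famPow_succ {F : Set (Finset ℕ)} (hF : IsRegular F) :
    ∀ n, famPow F (n + 1) = comp F (famPow F n)
  | 0 => (comp_schreierZero hF).symm
  | _ + 1 => rfl

theorem singleton_mem_famPow {F : Set (Finset ℕ)} (hF : IsRegular F) (hs : ∀ n, {n} ∈ F) (n : ℕ) :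
    ∀ i, {i} ∈ famPow F n := by
  induction n with
  | zero => exact fun i => Or.inr ⟨i, rfl⟩
  | succ n ih =>
    rw [famPow_succ hF]
    exact fun i => subset_comp hF hs (ih i)

theorem famPow_mono {F : Set (Finset ℕ)} (hF : IsRegular F) (hs : ∀ n, {n} ∈ F) :
    Monotone (famPow F) :=
  monotone_nat_of_le_succ fun n => by
    rw [famPow_succ hF]
    exact subset_comp hF hs

theorem famPow_add {F : Set (Finset ℕ)} (hF : IsRegular F) (hs : ∀ n, {n} ∈ F) (m n : ℕ) :
    famPow F (m + n) = comp (famPow F m) (famPow F n) := by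
  induction m with
  | zero =>
    rw [zero_add]
    exact (schreierZero_comp ((hF.famPow n).subset_mem (singleton_mem_famPow hF hs n 0)
      (Finset.empty_subset _))).symm
  | succ m ih =>
    rw [Nat.succ_add, famPow_succ hF, ih, famPow_succ hF,
      comp_assoc hF (hF.famPow m) (hF.famPow n)]

/-! ### The Schreier classes -/

theorem schreier_zero (c : Ordinal.{0} → ℕ → Ordinal.{0}) : schreier c 0 = schreierZero := by
  rw [schreier, Ordinal.limitRecOn_zero]

theorem schreier_add_one (c : Ordinal.{0} → ℕ → Ordinal.{0}) (α : Ordinal.{0}) :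
    schreier c (α + 1) = comp schreierOne (schreier c α) := by
  rw [schreier, Ordinal.limitRecOn_add_one]
  rfl

theorem schreier_limit (c : Ordinal.{0} → ℕ → Ordinal.{0}) {α : Ordinal.{0}}
    (h : Order.IsSuccLimit α) :
    schreier c α = {A | ∃ n, c α n < α ∧ A ∈ schreier c (c α n) ∧ ∀ i ∈ A, n ≤ i} := by
  rw [schreier, Ordinal.limitRecOn_limit _ _ _ _ h]
  ext A
  exact ⟨fun ⟨n, h1, h2⟩ => ⟨n, h1, h2⟩, fun ⟨n, h1, h2⟩ => ⟨n, h1, h2⟩⟩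

theorem singleton_mem_schreierOne (n : ℕ) : {n} ∈ schreierOne := by
  intro i hi
  simp

theorem isRegular_schreier (c : Ordinal.{0} → ℕ → Ordinal.{0}) (α : Ordinal.{0}) :
    IsRegular (schreier c α) := by
  induction α using Ordinal.limitRecOn with
  | zero => exact schreier_zero c ▸ isRegular_schreierZero
  | add_one α ih => exact schreier_add_one c α ▸ isRegular_schreierOne.comp ih
  | limit α h ih =>
    rw [schreier_limit c h]
    rintro A ⟨n, hn, hA, hle⟩ B f hf hB
    exact ⟨n, hn, ih _ hn A hA B f hf hB, fun b hb => (hle _ (hB b hb).1).trans (hB b hb).2⟩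

variable {c : Ordinal.{0} → ℕ → Ordinal.{0}}

theorem IsLadderSystem.lt_omega_one {α : Ordinal.{0}} (hc : IsLadderSystem c) (hα : α < ω₁)
    (h : Order.IsSuccLimit α) (n : ℕ) : c α n < ω₁ :=
  ((hc α hα h).2.1 n).trans hα

theorem singleton_mem_schreier (hc : IsLadderSystem c) {α : Ordinal.{0}} (hα : α < ω₁) :
    ∀ n, {n} ∈ schreier c α := by
  induction α using Ordinal.limitRecOn with
  | zero => exact schreier_zero c ▸ fun n => Or.inr ⟨n, rfl⟩
  | add_one α ih =>
    rw [schreier_add_one]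
    exact fun n => subset_comp isRegular_schreierOne singleton_mem_schreierOne
      (ih ((lt_add_one α).trans hα) n)
  | limit α h ih =>
    rw [schreier_limit c h]
    have hn := (hc α hα h).2.1 0
    exact fun n => ⟨0, hn, ih _ hn (hn.trans hα) n, fun _ _ => Nat.zero_le _⟩

theorem embeds_schreier_of_lt_ladder (hc : IsLadderSystem c) {α : Ordinal.{0}} (hα : α < ω₁)
    (h : Order.IsSuccLimit α) (n : ℕ) : Embeds (schreier c (c α n)) (schreier c α) := by
  refine (isRegular_schreier c _).embeds_of_ge n fun A hA hle => ?_
  rw [schreier_limit c h]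
  exact ⟨n, (hc α hα h).2.1 n, hA, hle⟩

/-- At a limit, `S_{α_n}` contributes only its sets starting at `n` or later, so a shift is needed
and an embedding takes the place of an inclusion. -/
theorem embeds_schreier_of_le (hc : IsLadderSystem c) {α : Ordinal.{0}} (hα : α < ω₁) :
    ∀ β ≤ α, Embeds (schreier c β) (schreier c α) := by
  induction α using Ordinal.limitRecOn with
  | zero =>
    intro β hβ
    rw [nonpos_iff_eq_zero.1 hβ]
    exact .of_subset subset_rfl
  | add_one α ih =>
    intro β hβ
    rcases hβ.eq_or_lt with rfl | hlt
    · exact .of_subset subset_rfl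
    · refine (ih ((lt_add_one α).trans hα) β (Order.lt_add_one_iff.1 hlt)).trans (.of_subset ?_)
      rw [schreier_add_one]
      exact subset_comp isRegular_schreierOne singleton_mem_schreierOne
  | limit α h ih =>
    intro β hβ
    rcases hβ.eq_or_lt with rfl | hlt
    · exact .of_subset subset_rfl
    · obtain ⟨n, hn⟩ := (hc α hα h).2.2 β hlt
      exact (ih _ ((hc α hα h).2.1 n) (hc.lt_omega_one hα h n) β hn.le).trans
        (embeds_schreier_of_lt_ladder hc hα h n)

theorem empty_mem_schreier (hc : IsLadderSystem c) {α : Ordinal.{0}} (hα : α < ω₁) :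
    ∅ ∈ schreier c α :=
  (isRegular_schreier c α).subset_mem (singleton_mem_schreier hc hα 0) (Finset.empty_subset _)

/-- Induction on `β`: associativity of composition handles successors, and diagonalization handles
limits. -/
theorem embeds_schreier_add (hc : IsLadderSystem c) (γ : Ordinal.{0}) {β : Ordinal.{0}}
    (hγβ : γ + β < ω₁) :
    Embeds (schreier c (γ + β)) (comp (schreier c β) (schreier c γ)) := by
  have hreg : ∀ β, IsRegular (comp (schreier c β) (schreier c γ)) := fun β =>
    (isRegular_schreier c β).comp (isRegular_schreier c γ)
  have hγ : γ < ω₁ := (le_self_add).trans_lt hγβ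
  induction β using Ordinal.limitRecOn with
  | zero =>
    rw [add_zero, schreier_zero, schreierZero_comp (empty_mem_schreier hc hγ)]
    exact .of_subset subset_rfl
  | add_one β ih =>
    rw [← add_assoc] at hγβ ⊢
    rw [schreier_add_one, schreier_add_one, ← comp_assoc isRegular_schreierOne
      (isRegular_schreier c β) (isRegular_schreier c γ)]
    exact .comp isRegular_schreierOne (hreg β) (.of_subset subset_rfl)
      (ih ((lt_add_one _).trans hγβ))
  | limit β h ih =>
    have hlim := Ordinal.isSuccLimit_add γ h
    have hβ : β < ω₁ := (le_add_self).trans_lt hγβ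
    refine Embeds.diagonal (K := fun n => schreier c (c (γ + β) n)) (hreg β) ?_ fun n => ?_
    · intro A hA
      rw [schreier_limit c hlim] at hA
      obtain ⟨n, -, h1, h2⟩ := hA
      exact ⟨n, h1, h2⟩
    · have hn := (hc _ hγβ hlim).2.1 n
      -- The approximating sequences of `γ + β` and `β` are unrelated. Each term of the former is at
      -- most `γ` plus its truncated difference with `γ`, and that difference stays below `β`.
      have hlt : c (γ + β) n - γ < β := by
        rcases le_or_gt γ (c (γ + β) n) with hle | hlt
        · rwa [Ordinal.sub_lt_of_le hle]
        · rw [Ordinal.sub_eq_zero_iff_le.2 hlt.le]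
          exact pos_of_ne_zero h.ne_bot
      have hlt' : γ + (c (γ + β) n - γ) < ω₁ := (add_le_add_right hlt.le γ).trans_lt hγβ
      exact ((embeds_schreier_of_le hc hlt' _ (Ordinal.le_add_sub _ _)).trans
        (ih _ hlt hlt')).trans (.comp (isRegular_schreier c _) (isRegular_schreier c γ)
          (embeds_schreier_of_le hc hβ _ hlt.le) (.of_subset subset_rfl))

theorem embeds_comp_schreier (hc : IsLadderSystem c) (γ : Ordinal.{0}) {β : Ordinal.{0}}
    (hγβ : γ + β < ω₁) :
    Embeds (comp (schreier c β) (schreier c γ)) (schreier c (γ + β)) := by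
  have hγ : γ < ω₁ := (le_self_add).trans_lt hγβ
  induction β using Ordinal.limitRecOn with
  | zero =>
    rw [add_zero, schreier_zero, schreierZero_comp (empty_mem_schreier hc hγ)]
    exact .of_subset subset_rfl
  | add_one β ih =>
    rw [← add_assoc] at hγβ ⊢
    rw [schreier_add_one, schreier_add_one, ← comp_assoc isRegular_schreierOne
      (isRegular_schreier c β) (isRegular_schreier c γ)]
    exact .comp isRegular_schreierOne (isRegular_schreier c _) (.of_subset subset_rfl)
      (ih ((lt_add_one _).trans hγβ))
  | limit β h ih =>
    have hβ : β < ω₁ := (le_add_self).trans_lt hγβ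
    refine Embeds.diagonal (K := fun n => comp (schreier c (c β n)) (schreier c γ))
      (isRegular_schreier c _) ?_ fun n => ?_
    · intro A hA
      obtain ⟨l, hl, hmono, hM, hfib⟩ := exists_label_of_mem_comp hA
      rw [schreier_limit c h] at hM
      obtain ⟨n, -, h1, h2⟩ := hM
      -- Every point is at least its label, so a lower bound `n` on the labels is one on the whole
      -- set.
      refine ⟨n, (isRegular_schreier c _).mem_comp h1 hmono (fun a ha =>
        ⟨Finset.mem_image_of_mem _ ha, (hl a ha).2.1⟩) hfib, fun a ha =>
          (h2 _ (Finset.mem_image_of_mem _ ha)).trans (hl a ha).2.1⟩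
    · have hn := (hc _ hβ h).2.1 n
      have hle : γ + c β n ≤ γ + β := add_le_add_right hn.le γ
      exact (ih _ hn (hle.trans_lt hγβ)).trans (embeds_schreier_of_le hc hγβ _ hle)

theorem mul_natCast_lt_omega_one {α : Ordinal.{0}} (hα : α < ω₁) (n : ℕ) :
    α * (n : Ordinal.{0}) < ω₁ := by
  have h := Ordinal.isPrincipal_add_omega 1
  induction n with
  | zero => simpa using Ordinal.omega_pos 1
  | succ n ih =>
    rw [Nat.cast_succ, mul_add_one]
    exact h ih hα

theorem embeds_schreier_mul_natCast (hc : IsLadderSystem c) {α : Ordinal.{0}} (hα : α < ω₁)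
    (n : ℕ) :
    Embeds (schreier c (α * (n : Ordinal.{0}))) (famPow (schreier c α) n) ∧
      Embeds (famPow (schreier c α) n) (schreier c (α * (n : Ordinal.{0}))) := by
  have hreg := isRegular_schreier c α
  induction n with
  | zero =>
    rw [Nat.cast_zero, mul_zero, schreier_zero]
    exact ⟨.of_subset subset_rfl, .of_subset subset_rfl⟩
  | succ n ih =>
    have hlt := mul_natCast_lt_omega_one hα (n + 1)
    rw [Nat.cast_succ, mul_add_one] at hlt ⊢
    rw [famPow_succ hreg]
    exact ⟨(embeds_schreier_add hc _ hlt).trans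
        (.comp hreg (hreg.famPow n) (.of_subset subset_rfl) ih.1),
      (Embeds.comp hreg (isRegular_schreier c _) (.of_subset subset_rfl) ih.2).trans
        (embeds_comp_schreier hc _ hlt)⟩

/-! ### Subsequences of block bases -/

theorem minElt_image {φ : ℕ → ℕ} (hφ : StrictMono φ) {E : Finset ℕ} (hE : E.Nonempty) :
    minElt (E.image φ) = φ (minElt E) := by
  refine le_antisymm (minElt_le (Finset.mem_image_of_mem _ (minElt_mem hE))) ?_
  obtain ⟨a, ha, e⟩ := Finset.mem_image.1 (minElt_mem (hE.image φ))
  rw [← e]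
  exact hφ.monotone (minElt_le ha)

section

variable {X : Type*} [NormedAddCommGroup X] [NormedSpace ℝ X]

theorem precedes_of_lt {a : ℕ → (ℕ →₀ ℝ)} (hne : ∀ i, a i ≠ 0)
    (h : ∀ i, Precedes (a i).support (a (i + 1)).support) {i j : ℕ} (hij : i < j) :
    Precedes (a i).support (a j).support := by
  induction j, hij using Nat.le_induction with
  | base => exact h i
  | succ j _ ih =>
    intro u hu w hw
    obtain ⟨z, hz⟩ := Finsupp.support_nonempty_iff.2 (hne j)
    exact (ih u hu z hz).trans (h j z hz w hw)

theorem IsBlockBasis.comp_strictMono {x e : ℕ → X} (hx : IsBlockBasis x e) {φ : ℕ → ℕ}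
    (hφ : StrictMono φ) : IsBlockBasis (x ∘ φ) e := by
  obtain ⟨a, hne, hprec, hxa⟩ := hx
  exact ⟨a ∘ φ, fun i => hne _, fun i => precedes_of_lt hne hprec (hφ (Nat.lt_succ_self i)),
    fun i => hxa _⟩

theorem HasLowerConstant.comp_strictMono {F G : Set (Finset ℕ)} {x : ℕ → X} {p : Seminorm ℝ X}
    {δ : ℝ≥0} (h : HasLowerConstant G x p δ) {φ : ℕ → ℕ} (hφ : StrictMono φ)
    (hFG : ∀ A ∈ F, A.image φ ∈ G) : HasLowerConstant F (x ∘ φ) p δ := by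
  intro k a ⟨hne, hprec, hmem⟩
  have hsupp : ∀ i, ((a i).mapDomain φ).support = (a i).support.image φ := fun i =>
    Finsupp.mapDomain_support_of_injective hφ.injective _
  have := h k (fun i => (a i).mapDomain φ) ?_
  · simpa only [Finsupp.linearCombination_mapDomain] using this
  simp only [hsupp]
  refine ⟨fun i => (hne i).image φ, fun i j hij u' hu' w' hw' => ?_, ?_⟩
  · obtain ⟨u, hu, rfl⟩ := Finset.mem_image.1 hu'
    obtain ⟨w, hw, rfl⟩ := Finset.mem_image.1 hw'
    exact hφ (hprec i j hij _ hu _ hw)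
  · have := hFG _ hmem
    rw [Finset.image_image] at this
    convert this using 2
    ext i
    exact minElt_image hφ (hne i)

/-- Replacing a block basis `x` by `x ∘ φ` turns `F`-admissible blocks into `G`-admissible blocks of
`x`, with the norm unchanged. -/
theorem ddotDelta_le_of_embeds {F G : Set (Finset ℕ)} (h : Embeds F G) (e : ℕ → X) :
    ddotDelta G e ≤ ddotDelta F e := by
  obtain ⟨φ, hφ, hFG⟩ := h
  refine iSup₂_mono fun p hp => iSup₂_le fun x hx => ?_
  refine le_iSup₂_of_le (x ∘ φ) (hx.comp_strictMono hφ) (iSup₂_le fun δ hδ => ?_)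
  exact le_iSup₂_of_le δ (hδ.comp_strictMono hφ hFG) le_rfl

theorem le_ddotDelta {F : Set (Finset ℕ)} {e x : ℕ → X} {p : Seminorm ℝ X} {δ : ℝ≥0}
    (hp : IsEquivNorm p) (hx : IsBlockBasis x e) (h : HasLowerConstant F x p δ) :
    (δ : ℝ≥0∞) ≤ ddotDelta F e :=
  le_iSup₂_of_le p hp (le_iSup₂_of_le x hx (le_iSup₂_of_le δ h le_rfl))

theorem ddotDelta_le {F : Set (Finset ℕ)} {e : ℕ → X} {b : ℝ≥0∞}
    (h : ∀ p : Seminorm ℝ X, IsEquivNorm p → ∀ x, IsBlockBasis x e → ∀ δ : ℝ≥0,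
      HasLowerConstant F x p δ → (δ : ℝ≥0∞) ≤ b) : ddotDelta F e ≤ b :=
  iSup₂_le fun p hp => iSup₂_le fun x hx => iSup₂_le fun δ hδ => h p hp x hx δ hδ

end

/-! ### Lower estimates for finitely supported sequences -/

/-- The points lying between `a ∈ A` (included) and the next element of `A` (excluded). -/
def cell (A : Finset ℕ) (a : ℕ) : Set ℕ := {i | a ≤ i ∧ ∀ b ∈ A, b ≤ i → b ≤ a}

theorem cell_anti {A B : Finset ℕ} (h : B ⊆ A) (a : ℕ) : cell A a ⊆ cell B a :=
  fun _ hi => ⟨hi.1, fun b hb => hi.2 b (h hb)⟩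

theorem eq_of_mem_cell {A : Finset ℕ} {a b i : ℕ} (ha : a ∈ A) (hb : b ∈ A) (hia : i ∈ cell A a)
    (hib : i ∈ cell A b) : a = b :=
  le_antisymm (hib.2 a ha hia.1) (hia.2 b hb hib.1)

theorem exists_mem_cell {A : Finset ℕ} {i : ℕ} (h : ∃ a ∈ A, a ≤ i) : ∃ a ∈ A, i ∈ cell A a := by
  obtain ⟨a, ha, hai⟩ := h
  have hne : (A.filter (· ≤ i)).Nonempty := ⟨a, Finset.mem_filter.2 ⟨ha, hai⟩⟩
  have := Finset.mem_filter.1 (Finset.max'_mem _ hne)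
  exact ⟨_, this.1, this.2, fun b hb hbi => Finset.le_max' _ _ (Finset.mem_filter.2 ⟨hb, hbi⟩)⟩

theorem lt_of_mem_cell {A : Finset ℕ} {a b i j : ℕ} (hb : b ∈ A) (hab : a < b)
    (hi : i ∈ cell A a) (hj : j ∈ cell A b) : i < j := by
  by_contra hle
  exact absurd (hi.2 b hb (hj.1.trans (not_lt.1 hle))) (not_le.2 hab)

theorem ordConnected_cell (A : Finset ℕ) (a : ℕ) : (cell A a).OrdConnected :=
  ⟨fun _ hx _ hy _ hz => ⟨hx.1.trans hz.1, fun b hb hbz => hy.2 b hb (hbz.trans hz.2)⟩⟩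

theorem IsRegular.image_mem_of_mem_cell {F : Set (Finset ℕ)} (hF : IsRegular F) {A B : Finset ℕ}
    (hA : A ∈ F) (hB : B ⊆ A) {s : ℕ → ℕ} (hs : ∀ a ∈ B, s a ∈ cell A a) : B.image s ∈ F := by
  refine hF.image_mem (g := id) hA (fun a ha => ⟨hB ha, (hs a ha).1⟩) fun a ha b hb hlt => ?_
  by_contra hle
  rcases (not_lt.1 hle).lt_or_eq with h | h
  · exact absurd (lt_of_mem_cell (hB ha) h (hs b hb) (hs a ha)) (not_lt.2 hlt.le)
  · rw [show b = a from h] at hlt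
    exact lt_irrefl _ hlt

/-- `p` satisfies a lower `ℓ₁` estimate with constant `δ` on `F`-admissible blocks, the blocks
being allowed to start late and to vanish. -/
def HasLowerBound (F : Set (Finset ℕ)) (p : Seminorm ℝ (ℕ →₀ ℝ)) (δ : ℝ≥0) : Prop :=
  ∀ A ∈ F, ∀ v : ℕ → (ℕ →₀ ℝ), (∀ a ∈ A, ((v a).support : Set ℕ) ⊆ cell A a) →
    (δ : ℝ) * ∑ a ∈ A, p (v a) ≤ p (∑ a ∈ A, v a)

theorem hasLowerBound_schreierZero (p : Seminorm ℝ (ℕ →₀ ℝ)) :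
    HasLowerBound schreierZero p 1 := by
  intro A hA v hv
  rcases hA with rfl | ⟨n, rfl⟩ <;> simp

/-- The estimate for `F` is applied to the sums over the fibres of the label, and the one for `G`
inside each fibre. -/
theorem HasLowerBound.comp {F G : Set (Finset ℕ)} {p : Seminorm ℝ (ℕ →₀ ℝ)} {δ ε : ℝ≥0}
    (hF : HasLowerBound F p δ) (hG : HasLowerBound G p ε) :
    HasLowerBound (comp F G) p (δ * ε) := by
  intro A hA v hv
  obtain ⟨h, hh, hmono, hM, hfib⟩ := exists_label_of_mem_comp hA
  have him : ∀ a ∈ A, h a ∈ A.image h := fun a ha => Finset.mem_image_of_mem h ha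
  have h1 := hF _ hM (fun m => ∑ a ∈ A with h a = m, v a) ?_
  · rw [Finset.sum_fiberwise_of_maps_to him] at h1
    refine le_trans ?_ h1
    rw [← Finset.sum_fiberwise_of_maps_to him, NNReal.coe_mul, mul_assoc, Finset.mul_sum _ _ (ε : ℝ)]
    refine mul_le_mul_of_nonneg_left (Finset.sum_le_sum fun m hm => ?_) δ.coe_nonneg
    exact hG _ (hfib m hm) v fun a ha =>
      (hv a (Finset.mem_filter.1 ha).1).trans (cell_anti (Finset.filter_subset _ _) a)
  · intro m hm i hi
    obtain ⟨a, haf, hia⟩ := Finset.mem_biUnion.1 (Finsupp.support_finsetSum (Finset.mem_coe.1 hi))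
    obtain ⟨ha, rfl⟩ := Finset.mem_filter.1 haf
    have hic := hv a ha hia
    -- A label up to `i` is a point of `A`, hence at most `a`. It is its own label, so monotonicity
    -- puts it below `h a`.
    refine ⟨(hh a ha).2.1.trans hic.1, fun m' hm' hle => ?_⟩
    obtain ⟨b, hb, rfl⟩ := Finset.mem_image.1 hm'
    rw [← (hh b hb).2.2]
    exact hmono (hh b hb).1 ha (hic.2 _ (hh b hb).1 hle)

theorem HasLowerBound.famPow {F : Set (Finset ℕ)} (hF : IsRegular F) {p : Seminorm ℝ (ℕ →₀ ℝ)}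
    {δ : ℝ≥0} (h : HasLowerBound F p δ) (n : ℕ) : HasLowerBound (famPow F n) p (δ ^ n) := by
  induction n with
  | zero => exact pow_zero δ ▸ hasLowerBound_schreierZero p
  | succ n ih =>
    rw [famPow_succ hF, pow_succ']
    exact h.comp ih

theorem HasLowerBound.famPow_mul {F : Set (Finset ℕ)} (hF : IsRegular F) (hs : ∀ n, {n} ∈ F)
    {p : Seminorm ℝ (ℕ →₀ ℝ)} {δ : ℝ≥0} {n : ℕ} (h : HasLowerBound (AsymptoticL1.famPow F n) p δ)
    (l : ℕ) : HasLowerBound (AsymptoticL1.famPow F (n * l)) p (δ ^ l) := by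
  induction l with
  | zero => exact pow_zero δ ▸ hasLowerBound_schreierZero p
  | succ l ih =>
    rw [Nat.mul_succ, add_comm, famPow_add hF hs, pow_succ']
    exact h.comp ih

section

variable {X : Type*} [NormedAddCommGroup X] [NormedSpace ℝ X]

theorem sum_orderEmbOfFin {M : Type*} [AddCommMonoid M] (B : Finset ℕ) (f : ℕ → M) :
    ∑ i, f (B.orderEmbOfFin rfl i) = ∑ a ∈ B, f a := by
  conv_rhs => rw [← Finset.map_orderEmbOfFin_univ B rfl, Finset.sum_map]
  rfl

/-- Blocks that vanish or start late cost nothing: after dropping the zero ones, the minima of the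
supports are a spread of a subset of `A`. Conversely, each block of an admissible sequence lies in
the cell of its own minimum. -/
theorem hasLowerConstant_iff {F : Set (Finset ℕ)} (hF : IsRegular F) {x : ℕ → X}
    {p : Seminorm ℝ X} {δ : ℝ≥0} :
    HasLowerConstant F x p δ ↔ HasLowerBound F (p.comp (Finsupp.linearCombination ℝ x)) δ := by
  constructor
  · intro h A hA v hv
    simp only [Seminorm.comp_apply, map_sum]
    set B := A.filter (fun a => v a ≠ 0) with hB
    have hmem := fun i => Finset.mem_filter.1 (B.orderEmbOfFin_mem rfl i)
    have hmin : ∀ a ∈ B, minElt (v a).support ∈ cell A a := fun a ha => by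
      obtain ⟨ha, h0⟩ := Finset.mem_filter.1 ha
      exact hv a ha (minElt_mem (Finsupp.support_nonempty_iff.2 h0))
    have := h B.card (fun i => v (B.orderEmbOfFin rfl i)) ⟨fun i =>
      Finsupp.support_nonempty_iff.2 (hmem i).2, fun i j hij u hu w hw => ?_, ?_⟩
    · rw [sum_orderEmbOfFin B fun a => p (Finsupp.linearCombination ℝ x (v a)),
        sum_orderEmbOfFin B fun a => Finsupp.linearCombination ℝ x (v a), hB,
        Finset.sum_filter_of_ne, Finset.sum_filter_of_ne] at this
      · exact this
      · exact fun a _ h0 h1 => h0 (by rw [h1, map_zero])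
      · exact fun a _ h0 h1 => h0 (by rw [h1, map_zero, map_zero])
    · exact lt_of_mem_cell (hmem j).1 ((B.orderEmbOfFin rfl).strictMono hij)
        (hv _ (hmem i).1 hu) (hv _ (hmem j).1 hw)
    · have h1 := hF.image_mem_of_mem_cell hA (Finset.filter_subset _ _) hmin
      rw [← hB, ← Finset.image_orderEmbOfFin_univ B rfl, Finset.image_image] at h1
      exact h1
  · intro h k a ⟨hne, hprec, hmem⟩
    have hinj : Function.Injective fun i => minElt (a i).support := by
      intro i j hij
      by_contra hne'
      have hij : minElt (a i).support = minElt (a j).support := hij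
      rcases lt_or_gt_of_ne hne' with hlt | hlt
      · exact (hprec i j hlt _ (minElt_mem (hne i)) _ (minElt_mem (hne j))).ne hij
      · exact (hprec j i hlt _ (minElt_mem (hne j)) _ (minElt_mem (hne i))).ne hij.symm
    have := h _ hmem (Function.extend (fun i => minElt (a i).support) a 0) ?_
    · rw [Finset.sum_image hinj.injOn, Finset.sum_image hinj.injOn] at this
      simpa only [hinj.extend_apply, Seminorm.comp_apply, map_sum] using this
    · intro m hm u hu
      obtain ⟨i, -, rfl⟩ := Finset.mem_image.1 hm
      rw [hinj.extend_apply] at hu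
      refine ⟨minElt_le hu, fun b hb hbu => ?_⟩
      obtain ⟨j, -, rfl⟩ := Finset.mem_image.1 hb
      rcases lt_trichotomy i j with hlt | rfl | hlt
      · exact absurd (hprec i j hlt u hu _ (minElt_mem (hne j))) (not_lt.2 hbu)
      · exact le_rfl
      · exact (hprec j i hlt _ (minElt_mem (hne j)) _ (minElt_mem (hne i))).le

theorem ddotDelta_pow_le {F : Set (Finset ℕ)} (hF : IsRegular F) (e : ℕ → X) {n : ℕ}
    (hn : 1 ≤ n) : ddotDelta F e ^ n ≤ ddotDelta (famPow F n) e := by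
  have hn0 : (0 : ℝ) < n := by exact_mod_cast hn
  -- Taking an `n`-th root on the right leaves a bare supremum on the left.
  rw [← ENNReal.rpow_natCast, ← ENNReal.le_rpow_inv_iff hn0]
  refine ddotDelta_le fun p hp x hx δ hδ => ?_
  rw [ENNReal.le_rpow_inv_iff hn0, ENNReal.rpow_natCast, ← ENNReal.coe_pow]
  exact le_ddotDelta hp hx ((hasLowerConstant_iff (hF.famPow n)).2
    (((hasLowerConstant_iff hF).1 hδ).famPow hF n))

end

/-! ### Restrictions of finitely supported sequences -/

open Classical in
/-- The restriction of a finitely supported sequence to a set of indices. -/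
noncomputable def restrict (E : Set ℕ) : (ℕ →₀ ℝ) →ₗ[ℝ] (ℕ →₀ ℝ) where
  toFun y := y.filter (· ∈ E)
  map_add' _ _ := Finsupp.filter_add
  map_smul' _ _ := Finsupp.filter_smul

open Classical in
theorem restrict_apply (E : Set ℕ) (y : ℕ →₀ ℝ) (i : ℕ) :
    restrict E y i = if i ∈ E then y i else 0 := Finsupp.filter_apply _ _ _

theorem restrict_restrict (E E' : Set ℕ) (y : ℕ →₀ ℝ) :
    restrict E (restrict E' y) = restrict (E ∩ E') y := by
  classical
  ext i
  simp only [restrict_apply, Set.mem_inter_iff, ite_and]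

theorem restrict_univ (y : ℕ →₀ ℝ) : restrict Set.univ y = y := by
  ext i
  simp [restrict_apply]

theorem mem_of_mem_support_restrict {E : Set ℕ} {y : ℕ →₀ ℝ} {i : ℕ}
    (h : i ∈ (restrict E y).support) : i ∈ E ∧ i ∈ y.support := by
  classical
  rw [Finsupp.mem_support_iff, restrict_apply] at h
  split_ifs at h with h1
  · exact ⟨h1, Finsupp.mem_support_iff.2 h⟩
  · exact absurd rfl h

theorem sum_restrict_cell (A : Finset ℕ) (y : ℕ →₀ ℝ) :
    ∑ a ∈ A, restrict (cell A a) y = restrict {i | ∃ a ∈ A, a ≤ i} y := by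
  classical
  ext i
  rw [Finsupp.finsetSum_apply, restrict_apply]
  simp only [restrict_apply, Set.mem_ofPred_eq]
  split_ifs with h
  · obtain ⟨a, ha, hi⟩ := exists_mem_cell h
    rw [Finset.sum_eq_single_of_mem a ha fun b hb hba => if_neg fun hib =>
      hba (eq_of_mem_cell hb ha hib hi), if_pos hi]
  · exact Finset.sum_eq_zero fun a ha => if_neg fun hi => h ⟨a, ha, hi.1⟩

theorem ordConnected_setOf_exists_le (A : Finset ℕ) : {i | ∃ a ∈ A, a ≤ i}.OrdConnected :=
  ⟨fun _ ⟨a, ha, hx⟩ _ _ _ hz => ⟨a, ha, hx.trans hz.1⟩⟩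

/-! ### Iterated norms -/

/-- The supremum of the values of `p` over all interval restrictions. -/
noncomputable def intervalNorm (p : Seminorm ℝ (ℕ →₀ ℝ)) : Seminorm ℝ (ℕ →₀ ℝ) :=
  ⨆ E : {E : Set ℕ // E.OrdConnected}, p.comp (restrict E)

/-- The sum of the interval norms over the cells of `A`. -/
noncomputable def cellNorm (p : Seminorm ℝ (ℕ →₀ ℝ)) (A : Finset ℕ) : Seminorm ℝ (ℕ →₀ ℝ) :=
  ∑ a ∈ A, (intervalNorm p).comp (restrict (cell A a))

/-- The supremum of the cell norms over `A ∈ G`. -/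
noncomputable def familyNorm (p : Seminorm ℝ (ℕ →₀ ℝ)) (G : Set (Finset ℕ)) :
    Seminorm ℝ (ℕ →₀ ℝ) :=
  ⨆ A : G, cellNorm p A

theorem cellNorm_apply (p : Seminorm ℝ (ℕ →₀ ℝ)) (A : Finset ℕ) (y : ℕ →₀ ℝ) :
    cellNorm p A y = ∑ a ∈ A, intervalNorm p (restrict (cell A a) y) := by
  rw [cellNorm, _root_.sum_apply]
  rfl

/-- Restrictions to intervals are bounded by `C` in the seminorm `p`. -/
def IntervalBound (p : Seminorm ℝ (ℕ →₀ ℝ)) (C : ℝ≥0) : Prop :=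
  ∀ E : Set ℕ, E.OrdConnected → ∀ y, p (restrict E y) ≤ C * p y

section

variable {p : Seminorm ℝ (ℕ →₀ ℝ)} {C : ℝ≥0}

theorem IntervalBound.bddAbove (hp : IntervalBound p C) :
    BddAbove (Set.range fun E : {E : Set ℕ // E.OrdConnected} => p.comp (restrict E)) := by
  refine ⟨C • p, ?_⟩
  rintro _ ⟨E, rfl⟩
  exact fun y => hp E E.2 y

theorem IntervalBound.le_intervalNorm (hp : IntervalBound p C) {E : Set ℕ} (hE : E.OrdConnected)
    (y : ℕ →₀ ℝ) : p (restrict E y) ≤ intervalNorm p y :=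
  le_ciSup hp.bddAbove ⟨E, hE⟩ y

theorem IntervalBound.self_le_intervalNorm (hp : IntervalBound p C) (y : ℕ →₀ ℝ) :
    p y ≤ intervalNorm p y := by
  simpa only [restrict_univ] using hp.le_intervalNorm Set.ordConnected_univ y

theorem intervalNorm_le {y : ℕ →₀ ℝ} (hp : IntervalBound p C) {b : ℝ}
    (h : ∀ E : Set ℕ, E.OrdConnected → p (restrict E y) ≤ b) : intervalNorm p y ≤ b := by
  have : Nonempty {E : Set ℕ // E.OrdConnected} := ⟨⟨_, Set.ordConnected_univ⟩⟩
  rw [intervalNorm, Seminorm.iSup_apply hp.bddAbove]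
  exact ciSup_le fun E => h E E.2

/-- Intervals are closed under intersection. Thus the interval norm decreases under interval
restriction with constant one, whereas `p` may lose a factor `C`. -/
theorem IntervalBound.intervalNorm_restrict_le (hp : IntervalBound p C) {E : Set ℕ}
    (hE : E.OrdConnected) (y : ℕ →₀ ℝ) : intervalNorm p (restrict E y) ≤ intervalNorm p y := by
  refine intervalNorm_le hp fun E' hE' => ?_
  rw [restrict_restrict]
  exact hp.le_intervalNorm (hE'.inter hE) y

/-- One factor `C` compares the interval norm with `p` on each cell. The other bounds the sum of the
pieces, which is the restriction of `y` to a final segment. -/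
theorem IntervalBound.cellNorm_le (hp : IntervalBound p C) {F : Set (Finset ℕ)} {δ : ℝ≥0}
    (hδ : 0 < δ) (h : HasLowerBound F p δ) {A : Finset ℕ} (hA : A ∈ F) :
    cellNorm p A ≤ (C * δ⁻¹ * C) • p := by
  intro y
  have h1 := h A hA (fun a => restrict (cell A a) y) fun a _ i hi =>
    (mem_of_mem_support_restrict hi).1
  rw [sum_restrict_cell] at h1
  have h2 := h1.trans (hp _ (ordConnected_setOf_exists_le A) y)
  have hδ' : (0 : ℝ) < δ := hδ
  rw [cellNorm_apply]
  calc ∑ a ∈ A, intervalNorm p (restrict (cell A a) y)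
      ≤ ∑ a ∈ A, C * p (restrict (cell A a) y) :=
        Finset.sum_le_sum fun a _ => intervalNorm_le hp fun E hE => hp E hE _
    _ = C * ((δ : ℝ)⁻¹ * (δ * ∑ a ∈ A, p (restrict (cell A a) y))) := by
        rw [inv_mul_cancel_left₀ hδ'.ne', Finset.mul_sum]
    _ ≤ C * ((δ : ℝ)⁻¹ * (C * p y)) := by gcongr
    _ = ((C * δ⁻¹ * C : ℝ≥0) • p) y := by
        rw [_root_.smul_apply, NNReal.smul_def, smul_eq_mul]
        push_cast
        ring

/-- Decompositions over the blocks of an `F`-admissible sequence combine into one. -/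
theorem IntervalBound.exists_sum_cellNorm_le (hp : IntervalBound p C) {F G : Set (Finset ℕ)}
    (hF : IsRegular F) (hG : IsRegular G) {M : Finset ℕ} (hM : M ∈ F) {v : ℕ → (ℕ →₀ ℝ)}
    (hv : ∀ m ∈ M, ((v m).support : Set ℕ) ⊆ cell M m) {A : ℕ → Finset ℕ}
    (hA : ∀ m ∈ M, A m ∈ G) :
    ∃ B ∈ comp F G, ∑ m ∈ M, cellNorm p (A m) (v m) ≤ cellNorm p B (∑ m ∈ M, v m) := by
  classical
  set N : ℕ → Finset ℕ := fun m => (A m).filter fun a => restrict (cell (A m) a) (v m) ≠ 0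
    with hN
  set s : ℕ → ℕ → ℕ := fun m a => minElt (restrict (cell (A m) a) (v m)).support with hs
  have hsmem : ∀ m, ∀ a ∈ N m, s m a ∈ cell (A m) a ∧ s m a ∈ (v m).support := fun m a ha =>
    mem_of_mem_support_restrict (minElt_mem
      (Finsupp.support_nonempty_iff.2 (Finset.mem_filter.1 ha).2))
  have hNA : ∀ m, N m ⊆ A m := fun m => Finset.filter_subset _ _
  have hsM : ∀ m ∈ M, ∀ a ∈ N m, s m a ∈ cell M m := fun m hm a ha => hv m hm (hsmem m a ha).2
  set B := M.biUnion fun m => (N m).image (s m) with hB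
  have hBmem : ∀ i ∈ B, ∃ m ∈ M, ∃ a ∈ N m, s m a = i := fun i hi => by
    simpa [hB] using hi
  have hex : ∀ i ∈ B, ∃ m ∈ M, i ∈ cell M m := fun i hi => by
    obtain ⟨m, hm, a, ha, rfl⟩ := hBmem i hi
    exact ⟨m, hm, hsM m hm a ha⟩
  choose! h hhM hh using hex
  refine ⟨B, hF.mem_comp (h := h) hM ?_ (fun a ha => ⟨hhM a ha, (hh a ha).1⟩) ?_, ?_⟩
  · intro i hi j hj hij
    exact (hh j hj).2 _ (hhM i hi) ((hh i hi).1.trans hij)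
  · intro m hm
    refine hG.subset_mem (hG.image_mem_of_mem_cell (hA m hm) (hNA m)
      fun a ha => (hsmem m a ha).1) fun i hi => ?_
    obtain ⟨hi, e⟩ := Finset.mem_filter.1 hi
    obtain ⟨m', hm', a, ha, rfl⟩ := hBmem i hi
    have : m' = m := eq_of_mem_cell hm' hm (hsM m' hm' a ha) (e ▸ hh _ hi)
    subst this
    exact Finset.mem_image_of_mem _ ha
  · have hdisj : (M : Set ℕ).PairwiseDisjoint fun m => (N m).image (s m) := by
      intro m hm m' hm' hne
      rw [Function.onFun, Finset.disjoint_left]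
      intro i hi hi'
      obtain ⟨a, ha, rfl⟩ := Finset.mem_image.1 hi
      obtain ⟨a', ha', e⟩ := Finset.mem_image.1 hi'
      exact hne (eq_of_mem_cell hm hm' (hsM m hm a ha) (e ▸ hsM m' hm' a' ha'))
    rw [cellNorm_apply, hB, Finset.sum_biUnion hdisj, ← hB]
    refine Finset.sum_le_sum fun m hm => ?_
    have hinj : Set.InjOn (s m) (N m) := fun a ha b hb e =>
      eq_of_mem_cell (hNA m ha) (hNA m hb) (hsmem m a ha).1 (e ▸ (hsmem m b hb).1)
    rw [cellNorm_apply, Finset.sum_image hinj, ← Finset.sum_filter_of_ne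
      (p := fun a => restrict (cell (A m) a) (v m) ≠ 0)
      fun a _ h0 h1 => h0 (by rw [h1, map_zero])]
    refine Finset.sum_le_sum fun a ha => ?_
    -- The `B`-cell at the start of a piece contains its support but may also meet parts of other
    -- blocks. Intersecting with two more intervals recovers the piece, and this cannot increase the
    -- interval norm.
    have hrest : restrict (cell (A m) a) (v m) =
        restrict (cell (A m) a ∩ cell M m) (restrict (cell B (s m a)) (∑ m ∈ M, v m)) := by
      ext i
      by_cases hi : i ∈ cell (A m) a
      swap
      · simp [restrict_apply, hi]
      by_cases hiM : i ∈ cell M m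
      swap
      · have : v m i = 0 := by
          by_contra h0
          exact hiM (hv m hm (Finsupp.mem_support_iff.2 h0))
        simp [restrict_apply, hiM, this]
      have hsum : (∑ m ∈ M, v m) i = v m i := by
        rw [Finsupp.finsetSum_apply]
        refine Finset.sum_eq_single_of_mem m hm fun m' hm' hne => ?_
        by_contra h0
        exact hne (eq_of_mem_cell hm' hm (hv m' hm' (Finsupp.mem_support_iff.2 h0)) hiM)
      by_cases h0 : v m i = 0
      · simp only [restrict_apply, hsum, h0, ite_self]
      have hiB : i ∈ cell B (s m a) := by
        refine ⟨minElt_le ?_, fun b hb hbi => ?_⟩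
        · rw [Finsupp.mem_support_iff, restrict_apply, if_pos hi]
          exact h0
        · obtain ⟨m', hm', a', ha', rfl⟩ := hBmem b hb
          rcases lt_trichotomy m' m with hlt | rfl | hlt
          · exact (lt_of_mem_cell hm hlt (hsM m' hm' a' ha') (hsM m hm a ha)).le
          · rcases lt_trichotomy a' a with hlt | rfl | hlt
            · exact (lt_of_mem_cell (hNA _ ha) hlt (hsmem _ a' ha').1 (hsmem _ a ha).1).le
            · exact le_rfl
            · exact absurd (lt_of_mem_cell (hNA _ ha') hlt hi (hsmem _ a' ha').1)
                (not_lt.2 hbi)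
          · exact absurd (lt_of_mem_cell hm' hlt hiM (hsM m' hm' a' ha')) (not_lt.2 hbi)
      simp only [restrict_apply, hsum, Set.mem_inter_iff, hi, hiM, hiB, and_self, if_true]
    rw [hrest]
    exact hp.intervalNorm_restrict_le ((ordConnected_cell _ _).inter (ordConnected_cell _ _)) _

end

theorem sum_ciSup_le {ι : Type*} [Nonempty ι] {M : Finset ℕ} {f : ℕ → ι → ℝ} {b : ℝ}
    (h : ∀ g : ℕ → ι, ∑ m ∈ M, f m (g m) ≤ b) : ∑ m ∈ M, ⨆ i, f m i ≤ b := by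
  refine le_of_forall_pos_le_add fun ε hε => ?_
  have hη : 0 < ε / (M.card + 1) := by positivity
  have hex : ∀ m, ∃ i, (⨆ i, f m i) - ε / (M.card + 1) < f m i := fun m =>
    exists_lt_of_lt_ciSup (sub_lt_self _ hη)
  choose g hg using hex
  calc ∑ m ∈ M, ⨆ i, f m i ≤ ∑ m ∈ M, (f m (g m) + ε / (M.card + 1)) :=
        Finset.sum_le_sum fun m _ => by linarith [hg m]
    _ = ∑ m ∈ M, f m (g m) + M.card * (ε / (M.card + 1)) := by
        rw [Finset.sum_add_distrib, Finset.sum_const, nsmul_eq_mul]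
    _ ≤ b + ε := by
        refine add_le_add (h g) ?_
        rw [← mul_div_assoc, div_le_iff₀ (by positivity)]
        nlinarith

/-- A lower estimate on the powers of `F` yields a renorming with a lower estimate on `F`. -/
theorem exists_renorming {F : Set (Finset ℕ)} (hF : IsRegular F) (hs : ∀ n, {n} ∈ F)
    {p : Seminorm ℝ (ℕ →₀ ℝ)} {C : ℝ≥0} (hp : IntervalBound p C) {N : ℕ} (hN : 1 ≤ N)
    {δ t : ℝ≥0} (hδ : 0 < δ) (h : HasLowerBound (famPow F N) p δ)
    (ht : t ^ N * (C * δ⁻¹ * C) ≤ 1) :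
    ∃ (P : Seminorm ℝ (ℕ →₀ ℝ)) (D : ℝ≥0), p ≤ P ∧ P ≤ D • p ∧ HasLowerBound F P t := by
  have hcell : ∀ j ≤ N, ∀ A ∈ famPow F j, cellNorm p A ≤ (C * δ⁻¹ * C) • p := fun j hj A hA =>
    hp.cellNorm_le hδ h (famPow_mono hF hs hj hA)
  have hne : ∀ j, Nonempty (famPow F j) := fun j => ⟨⟨_, singleton_mem_famPow hF hs j 0⟩⟩
  have hbdd : ∀ j ≤ N, BddAbove (Set.range fun A : famPow F j => cellNorm p A) := by
    intro j hj
    refine ⟨(C * δ⁻¹ * C) • p, ?_⟩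
    rintro _ ⟨A, rfl⟩
    exact hcell j hj A A.2
  have hle : ∀ j ≤ N, ∀ A ∈ famPow F j, ∀ y, cellNorm p A y ≤ familyNorm p (famPow F j) y :=
    fun j hj A hA y => le_ciSup (f := fun A : famPow F j => cellNorm p A) (hbdd j hj) ⟨A, hA⟩ y
  have hfam : ∀ j ≤ N, familyNorm p (famPow F j) ≤ (C * δ⁻¹ * C) • p := fun j hj =>
    have := hne j
    ciSup_le (f := fun A : famPow F j => cellNorm p A) fun A => hcell j hj A A.2
  have hzero : ∀ y, p y ≤ familyNorm p (famPow F 0) y := by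
    intro y
    refine le_trans ?_ (hle 0 (Nat.zero_le _) {0} (singleton_mem_famPow hF hs 0 0) y)
    -- The singleton `{0}` cuts nothing off.
    have : cell {0} 0 = Set.univ := by
      ext i
      simp [cell]
    rw [cellNorm_apply, Finset.sum_singleton, this, restrict_univ]
    exact hp.self_le_intervalNorm y
  have hsuper : ∀ j, j + 1 ≤ N → ∀ M ∈ F, ∀ v : ℕ → (ℕ →₀ ℝ),
      (∀ m ∈ M, ((v m).support : Set ℕ) ⊆ cell M m) →
      ∑ m ∈ M, familyNorm p (famPow F j) (v m) ≤
        familyNorm p (famPow F (j + 1)) (∑ m ∈ M, v m) := by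
    intro j hj M hM v hv
    have := hne j
    simp only [familyNorm, Seminorm.iSup_apply (hbdd j (Nat.le_of_succ_le hj))]
    refine sum_ciSup_le fun A => ?_
    obtain ⟨B, hB, hsum⟩ := hp.exists_sum_cellNorm_le hF (hF.famPow j) hM hv
      (A := fun m => A m) fun m _ => (A m).2
    rw [← famPow_succ hF] at hB
    exact hsum.trans (hle (j + 1) hj B hB _)
  have hP : ∀ y, (∑ j ∈ Finset.range N, t ^ j • familyNorm p (famPow F j)) y =
      ∑ j ∈ Finset.range N, (t : ℝ) ^ j * familyNorm p (famPow F j) y := by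
    intro y
    rw [_root_.sum_apply]
    rfl
  refine ⟨∑ j ∈ Finset.range N, t ^ j • familyNorm p (famPow F j),
    ∑ j ∈ Finset.range N, t ^ j * (C * δ⁻¹ * C), fun y => ?_, fun y => ?_, fun M hM v hv => ?_⟩
  · rw [hP]
    refine (hzero y).trans ?_
    have := Finset.single_le_sum (f := fun j => (t : ℝ) ^ j * familyNorm p (famPow F j) y)
      (fun j _ => mul_nonneg (pow_nonneg t.coe_nonneg j) (apply_nonneg _ y))
      (Finset.mem_range.2 hN)
    simpa using this
  · rw [hP, _root_.smul_apply, NNReal.smul_def, smul_eq_mul, NNReal.coe_sum, Finset.sum_mul]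
    refine Finset.sum_le_sum fun j hj => ?_
    rw [NNReal.coe_mul, NNReal.coe_pow, mul_assoc]
    exact mul_le_mul_of_nonneg_left (hfam j (Finset.mem_range.1 hj).le y)
      (pow_nonneg t.coe_nonneg j)
  · simp only [hP]
    set Y := ∑ m ∈ M, v m
    -- This closes the cycle: the top level, weighted by `t ^ N`, is absorbed by the bottom one.
    have hlast : (t : ℝ) ^ N * familyNorm p (famPow F N) Y ≤ familyNorm p (famPow F 0) Y := by
      have h1 : ((t ^ N * (C * δ⁻¹ * C) : ℝ≥0) : ℝ) ≤ 1 := by exact_mod_cast ht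
      rw [NNReal.coe_mul, NNReal.coe_pow] at h1
      calc (t : ℝ) ^ N * familyNorm p (famPow F N) Y
          ≤ (t : ℝ) ^ N * (((C * δ⁻¹ * C : ℝ≥0) : ℝ) * p Y) :=
            mul_le_mul_of_nonneg_left (hfam N le_rfl Y) (pow_nonneg t.coe_nonneg N)
        _ ≤ 1 * p Y := by
            rw [← mul_assoc]
            exact mul_le_mul_of_nonneg_right h1 (apply_nonneg p Y)
        _ ≤ _ := by rw [one_mul]; exact hzero Y
    calc (t : ℝ) * ∑ m ∈ M, ∑ j ∈ Finset.range N, (t : ℝ) ^ j * familyNorm p (famPow F j) (v m)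
        = ∑ j ∈ Finset.range N,
            (t : ℝ) ^ (j + 1) * ∑ m ∈ M, familyNorm p (famPow F j) (v m) := by
          rw [Finset.sum_comm, Finset.mul_sum]
          refine Finset.sum_congr rfl fun j _ => ?_
          rw [← Finset.mul_sum, pow_succ', mul_assoc]
      _ ≤ ∑ j ∈ Finset.range N, (t : ℝ) ^ (j + 1) * familyNorm p (famPow F (j + 1)) Y :=
          Finset.sum_le_sum fun j hj => mul_le_mul_of_nonneg_left
            (hsuper j (Finset.mem_range.1 hj) M hM v hv) (pow_nonneg t.coe_nonneg _)
      _ ≤ ∑ j ∈ Finset.range N, (t : ℝ) ^ j * familyNorm p (famPow F j) Y := by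
          -- The two sums differ only in the terms of index `N` and `0`, which `hlast` compares.
          have h1 := Finset.sum_range_succ
            (fun j => (t : ℝ) ^ j * familyNorm p (famPow F j) Y) N
          rw [Finset.sum_range_succ', pow_zero, one_mul] at h1
          linarith

/-! ### Equivalent norms on the space and basis projections -/

section

variable {X : Type*} [NormedAddCommGroup X] [NormedSpace ℝ X]

/-- A seminorm on the domain of `T` which is equivalent to the norm pulled back along `T` is the
pullback of an equivalent norm. -/
theorem exists_equivNorm_extending {V : Type*} [AddCommGroup V] [Module ℝ V] (T : V →ₗ[ℝ] X)
    (P : Seminorm ℝ V) {c D : ℝ} (hc : 0 < c) (hD : 0 < D) (hcP : ∀ a, c * ‖T a‖ ≤ P a)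
    (hPD : ∀ a, P a ≤ D * ‖T a‖) :
    ∃ p : Seminorm ℝ X, IsEquivNorm p ∧ p.comp T = P := by
  have hnonneg : ∀ z a, 0 ≤ P a + D * ‖z - T a‖ := fun z a =>
    add_nonneg (apply_nonneg P a) (mul_nonneg hD.le (norm_nonneg _))
  have hbdd : ∀ z, BddBelow (Set.range fun a => P a + D * ‖z - T a‖) := fun z => by
    refine ⟨0, ?_⟩
    rintro _ ⟨a, rfl⟩
    exact hnonneg z a
  have hle : ∀ z, ⨅ a, (P a + D * ‖z - T a‖) ≤ D * ‖z‖ := fun z =>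
    (ciInf_le (hbdd z) 0).trans (by simp)
  -- The infimal convolution of `P` on the range of `T` with `D * ‖·‖` on `X`. The bound `P ≤ D * ‖T
  -- ·‖` ensures that it pulls back to `P` itself.
  set p : Seminorm ℝ X := Seminorm.ofSMulLE (fun z => ⨅ a, (P a + D * ‖z - T a‖))
    (le_antisymm ((hle 0).trans (by simp)) (Real.iInf_nonneg (hnonneg 0)))
    (fun y z => by
      refine le_ciInf_add_ciInf fun a b => (ciInf_le (hbdd _) (a + b)).trans ?_
      have h1 := map_add_le_add P a b
      have h2 : ‖y + z - T (a + b)‖ ≤ ‖y - T a‖ + ‖z - T b‖ := by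
        rw [map_add, add_sub_add_comm]
        exact norm_add_le _ _
      nlinarith)
    (fun r z => by
      rw [Real.mul_iInf_of_nonneg (norm_nonneg r)]
      refine le_ciInf fun a => (ciInf_le (hbdd _) (r • a)).trans (le_of_eq ?_)
      rw [map_smul T, ← smul_sub, norm_smul, map_smul_eq_mul]
      ring) with hp
  have hpz : ∀ z, p z = ⨅ a, (P a + D * ‖z - T a‖) := fun z => rfl
  refine ⟨p, ⟨min c D, D, lt_min hc hD, hD, fun z => ⟨?_, hle z⟩⟩, ?_⟩
  · rw [hpz]
    refine le_ciInf fun a => ?_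
    have h1 : ‖z‖ ≤ ‖T a‖ + ‖z - T a‖ := by
      simpa using norm_add_le (T a) (z - T a)
    calc min c D * ‖z‖ ≤ min c D * (‖T a‖ + ‖z - T a‖) :=
          mul_le_mul_of_nonneg_left h1 (lt_min hc hD).le
      _ ≤ c * ‖T a‖ + D * ‖z - T a‖ := by
          rw [mul_add]
          exact add_le_add (mul_le_mul_of_nonneg_right (min_le_left _ _) (norm_nonneg _))
            (mul_le_mul_of_nonneg_right (min_le_right _ _) (norm_nonneg _))
      _ ≤ P a + D * ‖z - T a‖ := add_le_add_left (hcP a) _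
  · ext b
    rw [Seminorm.comp_apply, hpz]
    refine le_antisymm ((ciInf_le (hbdd _) b).trans (by simp)) (le_ciInf fun a => ?_)
    calc P b = P (a + (b - a)) := by rw [add_sub_cancel]
      _ ≤ P a + P (b - a) := map_add_le_add P _ _
      _ ≤ P a + D * ‖T b - T a‖ := by
          rw [← map_sub]
          exact add_le_add_right (hPD _) _

/-- On a given finitely supported `y`, even an infinite interval acts as the segment between the
extreme points of the restricted support. -/
theorem exists_restrict_eq_sub {E : Set ℕ} (hE : E.OrdConnected) (y : ℕ →₀ ℝ) :
    ∃ m n, restrict E y = restrict (Set.Iio m) y - restrict (Set.Iio n) y := by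
  classical
  rcases (restrict E y).support.eq_empty_or_nonempty with h | h
  · exact ⟨0, 0, by rw [sub_self, Finsupp.support_eq_empty.1 h]⟩
  have hmax := mem_of_mem_support_restrict (Finset.max'_mem _ h)
  have hmin := mem_of_mem_support_restrict (Finset.min'_mem _ h)
  set m := (restrict E y).support.max' h
  set n := (restrict E y).support.min' h
  refine ⟨m + 1, n, ?_⟩
  have hnm : n ≤ m := Finset.min'_le_max' _ h
  ext i
  rw [Finsupp.sub_apply]
  by_cases h0 : y i = 0
  · simp only [restrict_apply, h0, ite_self, sub_self]
  have key : i ∈ E ↔ n ≤ i ∧ i ≤ m := by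
    refine ⟨fun hi => ?_, fun hi => hE.out hmin.1 hmax.1 hi⟩
    have : i ∈ (restrict E y).support := by
      rw [Finsupp.mem_support_iff, restrict_apply, if_pos hi]
      exact h0
    exact ⟨Finset.min'_le _ _ this, Finset.le_max' _ _ this⟩
  simp only [restrict_apply, key, Set.mem_Iio]
  split_ifs <;> first | omega | simp

/-- Initial projections along a block basis are restrictions of initial projections of the
basis. -/
theorem linearCombination_restrict_Iio (e : SchauderBasis ℝ X) {x : ℕ → X}
    (hx : IsBlockBasis x e) (m : ℕ) : ∃ k, ∀ y, Finsupp.linearCombination ℝ x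
      (restrict (Set.Iio m) y) = e.proj k (Finsupp.linearCombination ℝ x y) := by
  classical
  obtain ⟨a, hne, hprec, hxa⟩ := hx
  have hmin := minElt_mem (Finsupp.support_nonempty_iff.2 (hne m))
  -- Projecting onto the coordinates before the start of `x m` fixes `x i` for `i < m` and kills the
  -- others.
  refine ⟨minElt (a m).support, fun y => ?_⟩
  have hproj : ∀ i, e.proj (minElt (a m).support) (x i) = if i < m then x i else 0 := by
    intro i
    rw [hxa, Finsupp.linearCombination_apply, Finsupp.sum, map_sum]
    split_ifs with h
    · refine Finset.sum_congr rfl fun u hu => ?_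
      rw [map_smul, SchauderBasis.proj_apply_basis_mem,
        if_pos (precedes_of_lt hne hprec h u hu _ hmin)]
    · refine Finset.sum_eq_zero fun u hu => ?_
      rw [map_smul, SchauderBasis.proj_apply_basis_mem, if_neg, smul_zero]
      rcases (not_lt.1 h).lt_or_eq with h | rfl
      · exact not_lt.2 (precedes_of_lt hne hprec h _ hmin u hu).le
      · exact not_lt.2 (minElt_le hu)
  induction y using Finsupp.induction_linear with
  | zero => simp
  | add y z hy hz => simp only [map_add, hy, hz]
  | single i r =>
    rw [Finsupp.linearCombination_single, map_smul, hproj]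
    have : restrict (Set.Iio m) (Finsupp.single i r) = if i < m then Finsupp.single i r else 0 := by
      ext j
      rw [restrict_apply]
      by_cases hij : i = j
      · subst hij
        by_cases h : i < m <;> simp [h]
      · by_cases h : i < m <;> simp [h, Finsupp.single_eq_of_ne' hij]
    rw [this]
    split_ifs <;> simp

theorem exists_intervalBound [CompleteSpace X] (e : SchauderBasis ℝ X) {x : ℕ → X}
    (hx : IsBlockBasis x e) {p : Seminorm ℝ X} (hp : IsEquivNorm p) :
    ∃ C : ℝ≥0, IntervalBound (p.comp (Finsupp.linearCombination ℝ x)) C := by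
  obtain ⟨c, C, hc, hC, hpc⟩ := hp
  obtain ⟨K, hK⟩ := e.exists_norm_proj_le
  have hK0 : 0 ≤ K := (norm_nonneg _).trans (hK 0)
  -- An interval restriction is a difference of two basis projections, each of norm at most `K`; the
  -- factor `C / c` accounts for the change of norm.
  refine ⟨⟨C * (2 * K) / c, by positivity⟩, fun E hE y => ?_⟩
  obtain ⟨m, n, hmn⟩ := exists_restrict_eq_sub hE y
  obtain ⟨k, hk⟩ := linearCombination_restrict_Iio e hx m
  obtain ⟨l, hl⟩ := linearCombination_restrict_Iio e hx n
  rw [Seminorm.comp_apply, Seminorm.comp_apply, hmn, map_sub, hk, hl]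
  set z := Finsupp.linearCombination ℝ x y
  have h1 : ∀ k, ‖e.proj k z‖ ≤ K * ‖z‖ := fun k =>
    ((e.proj k).le_opNorm z).trans (mul_le_mul_of_nonneg_right (hK k) (norm_nonneg z))
  have h2 : ‖z‖ ≤ p z / c := by
    rw [le_div_iff₀ hc, mul_comm]
    exact (hpc z).1
  calc p (e.proj k z - e.proj l z) ≤ C * ‖e.proj k z - e.proj l z‖ := (hpc _).2
    _ ≤ C * (K * ‖z‖ + K * ‖z‖) := by
        refine mul_le_mul_of_nonneg_left ((norm_sub_le _ _).trans ?_) hC.le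
        exact add_le_add (h1 k) (h1 l)
    _ = C * (2 * K) * ‖z‖ := by ring
    _ ≤ C * (2 * K) * (p z / c) := by gcongr
    _ = C * (2 * K) / c * p z := by ring

/-! ### The power formula -/

theorem exists_pow_mul_le_one {n : ℕ} {t δ : ℝ≥0} (ht : t ^ n < δ) (C : ℝ≥0) :
    ∃ l, 1 ≤ l ∧ t ^ (n * l) * (C * (δ ^ l)⁻¹ * C) ≤ 1 := by
  have hδ : 0 < δ := (zero_le).trans_lt ht
  have hr : t ^ n / δ < 1 := (div_lt_one hδ).2 ht
  obtain ⟨l, hl⟩ := exists_pow_lt_of_lt_one (show 0 < (C * C + 1)⁻¹ by positivity) hr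
  refine ⟨l + 1, Nat.le_add_left _ _, ?_⟩
  calc t ^ (n * (l + 1)) * (C * (δ ^ (l + 1))⁻¹ * C)
      = (t ^ n / δ) ^ (l + 1) * (C * C) := by
        rw [div_pow, ← pow_mul, div_eq_mul_inv]
        ring
    _ ≤ (C * C + 1)⁻¹ * (C * C + 1) := by
        refine mul_le_mul' ?_ le_self_add
        exact (pow_le_pow_of_le_one (zero_le) hr.le (Nat.le_succ l)).trans hl.le
    _ = 1 := inv_mul_cancel₀ (by positivity)

/-- Renorming directly with `[F]^n` would lose the factor `C²`. Passing to `[F]^(n * l)` makes this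
fixed loss negligible against the power `(t ^ n / δ) ^ l`. -/
theorem le_ddotDelta_of_pow_lt [CompleteSpace X] (e : SchauderBasis ℝ X) {F : Set (Finset ℕ)}
    (hF : IsRegular F) (hs : ∀ n, {n} ∈ F) {n : ℕ} (hn : 1 ≤ n) {p : Seminorm ℝ X}
    (hp : IsEquivNorm p) {x : ℕ → X} (hx : IsBlockBasis x e) {δ t : ℝ≥0}
    (h : HasLowerConstant (famPow F n) x p δ) (ht : t ^ n < δ) :
    (t : ℝ≥0∞) ≤ ddotDelta F e := by
  obtain ⟨C, hC⟩ := exists_intervalBound e hx hp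
  obtain ⟨l, hl, htl⟩ := exists_pow_mul_le_one ht C
  have hδ : 0 < δ := (zero_le).trans_lt ht
  obtain ⟨P, D, hpP, hPD, hP⟩ := exists_renorming hF hs hC (Nat.mul_pos hn hl)
    (pow_pos hδ l) (((hasLowerConstant_iff (hF.famPow n)).1 h).famPow_mul hF hs l) htl
  obtain ⟨b, B, hb, hB, hpb⟩ := hp
  -- The upper constant must be positive and `D` may vanish, hence `D + 1`.
  obtain ⟨q, hq, hqP⟩ := exists_equivNorm_extending (Finsupp.linearCombination ℝ x) P
    (D := (D + 1) * B) hb (by positivity) (fun y => (hpb _).1.trans (hpP y)) fun y => by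
      calc P y ≤ D * p (Finsupp.linearCombination ℝ x y) := hPD y
        _ ≤ (D + 1) * (B * ‖Finsupp.linearCombination ℝ x y‖) :=
          mul_le_mul (by linarith) (hpb _).2 (apply_nonneg _ _) (by positivity)
        _ = _ := by ring
  exact le_ddotDelta hq hx ((hasLowerConstant_iff hF).2 (hqP ▸ hP))

theorem ddotDelta_famPow [CompleteSpace X] (e : SchauderBasis ℝ X) {F : Set (Finset ℕ)}
    (hF : IsRegular F) (hs : ∀ n, {n} ∈ F) {n : ℕ} (hn : 1 ≤ n) :
    ddotDelta (famPow F n) e = ddotDelta F e ^ n := by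
  refine le_antisymm (ddotDelta_le fun p hp x hx δ hδ => ?_) (ddotDelta_pow_le hF e hn)
  have hn0 : (0 : ℝ) < n := by exact_mod_cast hn
  rw [← ENNReal.rpow_natCast, ← ENNReal.rpow_inv_le_iff hn0]
  refine ENNReal.le_of_forall_nnreal_lt fun t ht => ?_
  refine le_ddotDelta_of_pow_lt e hF hs hn hp hx hδ ?_
  rw [ENNReal.lt_rpow_inv_iff hn0, ENNReal.rpow_natCast] at ht
  exact_mod_cast ht

end

end AsymptoticL1

theorem proposition4p15 {X : Type*} [NormedAddCommGroup X] [NormedSpace ℝ X] [CompleteSpace X]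
    (e : SchauderBasis ℝ X)
    (c : Ordinal.{0} → ℕ → Ordinal.{0}) (hc : AsymptoticL1.IsLadderSystem c)
    (α : Ordinal.{0}) (hα : α < ω₁) (n : ℕ) (hn : 1 ≤ n) :
    AsymptoticL1.ddotDelta (AsymptoticL1.famPow (AsymptoticL1.schreier c α) n) e =
        AsymptoticL1.ddotDelta (AsymptoticL1.schreier c α) e ^ n ∧
      AsymptoticL1.ddotDelta (AsymptoticL1.famPow (AsymptoticL1.schreier c α) n) e =
        AsymptoticL1.ddotDelta (AsymptoticL1.schreier c (α * (n : Ordinal.{0}))) e ∧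
      AsymptoticL1.ddotDelta (AsymptoticL1.schreier c (α * (n : Ordinal.{0}))) e =
        AsymptoticL1.ddotDelta (AsymptoticL1.schreier c α) e ^ n := by
  have h1 := AsymptoticL1.ddotDelta_famPow e (AsymptoticL1.isRegular_schreier c α)
    (AsymptoticL1.singleton_mem_schreier hc hα) hn
  obtain ⟨h2, h3⟩ := AsymptoticL1.embeds_schreier_mul_natCast hc hα n
  have h4 := le_antisymm (AsymptoticL1.ddotDelta_le_of_embeds h2 e)
    (AsymptoticL1.ddotDelta_le_of_embeds h3 e)
  exact ⟨h1, h4, h4.symm.trans h1⟩
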